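/- Let $\mathcal C$ be a monoidal category, with unit $\mathbb 1$, not necessarily closed, such that $\otimes$ preserves colimits in each variable. Let $(P,Q)$ be a pivotal pair in $\mathcal C$, that is, two objects together with chosen morphisms $\mathrm{coev}:\mathbb 1\to P\otimes Q$, $\mathrm{ev}:Q\otimes P\to\mathbb 1$ making $Q$ a left dual of $P$ and $\overline{\mathrm{coev}}:\mathbb 1\to Q\otimes P$, $\overline{\mathrm{ev}}:P\otimes Q\to\mathbb 1$ making $Q$ a right dual of $P$. (Associativity and unit isomorphisms are suppressed, and an object also denotes its identity morphism.) Put $F_+=Q\otimes-\otimes P$ and $F_-=P\otimes-\otimes Q$, and for a word $w=(i_1,\dots,i_n)$ in $\{+,-\}$ put $F_w=F_{i_1}\cdots F_{i_n}$ ($F_\emptyset=\mathrm{id}$). Consider the diagram in $\mathrm{End}(\mathcal C)$ consisting of all the $F_w$ and, for all words $u,w$, of the images under $F_u$ of the four pairs of natural transformations $$P\otimes Q\otimes F_w\rightrightarrows F_{-,+,w},\,F_w:\quad P\otimes Q\otimes F_w\otimes\mathrm{coev},\ \ \overline{\mathrm{ev}}\otimes F_w;$$ $$F_w\otimes P\otimes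 Q\rightrightarrows F_{-,+,w},\,F_w:\quad \mathrm{coev}\otimes F_w\otimes P\otimes Q,\ \ F_w\otimes\overline{\mathrm{ev}};$$ $$Q\otimes P\otimes F_w\rightrightarrows F_{+,-,w},\,F_w:\quad Q\otimes P\otimes F_w\otimes\overline{\mathrm{coev}},\ \ \mathrm{ev}\otimes F_w;$$ $$F_w\otimes Q\otimes P\rightrightarrows F_{+,-,w},\,F_w:\quad \overline{\mathrm{coev}}\otimes F_w\otimes Q\otimes P,\ \ F_w\otimes\mathrm{ev}.$$ Assume that for every object $X$ the diagram of the objects $F_w(X)$ obtained by evaluation at $X$ has a colimit in $\mathcal C$, and let $T\in\mathrm{End}(\mathcal C)$ be the (objectwise) colimit, with canonical transformations $\psi_w:F_w\Rightarrow T$ (so the two morphisms of each pair agree after composition with the $\psi$'s). Then $T$ has a unique bimonad structure $(\mu,\eta,T_2,T_0)$ (monad with compatible comonoidal structure) such that $\eta=\psi_\emptyset$ and, for all words $w,v$, $$\mu\,(\psi_w)_{T(X)}\,F_w((\psi_v)_X)=(\psi_{wv})_X,\qquad T_2\,(\psi_w)_{X\otimes Y}=\big((\psi_w)_X\otimes(\psi_w)_Y\big)F_w(X\otimes\mathrm{coev}_w\otimes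 Y),\qquad T_0\,(\psi_w)_{\mathbb 1}=\mathrm{ev}_w,$$ where for $w=(i_1,\dots,i_n)$ we write $-w^{\mathrm{rev}}=(-i_n,\dots,-i_1)$, and $\mathrm{coev}_w:\mathbb 1\to F_{-w^{\mathrm{rev}}}(\mathbb 1)$, $\mathrm{ev}_w:F_w(\mathbb 1)\to\mathbb 1$ are the iterated (nested) coevaluations and evaluations, given by $\mathrm{coev}_\emptyset=\mathrm{ev}_\emptyset=\mathrm{id}_{\mathbb 1}$, $\mathrm{coev}_+=\mathrm{coev}$, $\mathrm{coev}_-=\overline{\mathrm{coev}}$, $\mathrm{ev}_+=\mathrm{ev}$, $\mathrm{ev}_-=\overline{\mathrm{ev}}$, $\mathrm{coev}_{i,w}=F_{-w^{\mathrm{rev}}}(\mathrm{coev}_i)\,\mathrm{coev}_w$, $\mathrm{ev}_{i,w}=\mathrm{ev}_i\,F_i(\mathrm{ev}_w)$. For this structure the following hold. (1) The category of $T$-modules is isomorphic, over $\mathcal C$, to the category $\mathcal C(P,Q)$ of $P$-$Q$ intertwined objects. Its objects are pairs $(X,\sigma)$ with $\sigma:X\otimes P\to P\otimes X$ invertible such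 that $(\mathrm{ev}\otimes X\otimes Q)(Q\otimes\sigma\otimes Q)(Q\otimes X\otimes\mathrm{coev})$ and $(Q\otimes X\otimes\overline{\mathrm{ev}})(Q\otimes\sigma^{-1}\otimes Q)(\overline{\mathrm{coev}}\otimes X\otimes Q)$ are inverse to each other; morphisms $(X,\sigma)\to(Y,\tau)$ are the $f:X\to Y$ with $\tau(f\otimes P)=(P\otimes f)\sigma$. The $T$-action on $(X,\sigma)$ is the morphism $\theta:T(X)\to X$ for which $\theta\,(\psi_w)_X$ is the iterate along $w$ of the actions $(\mathrm{ev}\otimes X)(Q\otimes\sigma):F_+(X)\to X$ and $(X\otimes\overline{\mathrm{ev}})(\sigma^{-1}\otimes Q):F_-(X)\to X$. (2) $T$ is a (left and right) Hopf monad: the fusion operators $$H^l_{X,Y}=(T(X)\otimes\mu_Y)\,T_2(X,T(Y)):T(X\otimes T(Y))\to T(X)\otimes T(Y),$$ $$H^r_{X,Y}=(\mu_X\otimes T(Y))\,T_2(T(X),Y):T(T(X)\otimes Y)\to T(X)\otimes T(Y)$$ are invertible for all $X,Y$. (3) The inverses are the unique morphisms such that, for all words $w,v$, $$(H^l_{X,Y})^{-1}\big((\psi_w)_X\otimes(\psi_v)_Y\big)=(\psi_w)_{X\otimes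 T(Y)}\,F_w\big(X\otimes(\psi_{-w^{\mathrm{rev}},v})_Y\big)\,\big(F_w(X)\otimes F_v(Y)\otimes\mathrm{coev}_{-w^{\mathrm{rev}}}\big),$$ $$(H^r_{X,Y})^{-1}\big((\psi_w)_X\otimes(\psi_v)_Y\big)=(\psi_v)_{T(X)\otimes Y}\,F_v\big((\psi_{-v^{\mathrm{rev}},w})_X\otimes Y\big)\,\big(\mathrm{coev}_{-v^{\mathrm{rev}}}\otimes F_w(X)\otimes F_v(Y)\big).$$ -/

import Mathlib

open CategoryTheory MonoidalCategory CategoryTheory.Limits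

universe v u

/-! ### Bimonads and their fusion operators -/

/-- A bimonad (comonoidal monad) structure on an endofunctor `T` of a monoidal category:
a monad structure, a comonoidal structure, and the four compatibility conditions. -/
structure BimonadOn {C : Type u} [Category.{v} C] [MonoidalCategory C] (T : C ⥤ C) where
  /-- the unit of the monad -/
  unit : 𝟭 C ⟶ T
  /-- the multiplication of the monad -/
  mul : T ⋙ T ⟶ T
  mul_assoc : ∀ X : C, T.map (mul.app X) ≫ mul.app X = mul.app (T.obj X) ≫ mul.app X
  left_unit : ∀ X : C, unit.app (T.obj X) ≫ mul.app X = 𝟙 (T.obj X)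
  right_unit : ∀ X : C, T.map (unit.app X) ≫ mul.app X = 𝟙 (T.obj X)
  /-- the comonoidal structure `T₂ = δ`, `T₀ = η` -/
  oplax : T.OplaxMonoidal
  mul_comul : ∀ X Y : C, mul.app (X ⊗ Y) ≫ oplax.δ X Y =
    T.map (oplax.δ X Y) ≫ oplax.δ (T.obj X) (T.obj Y) ≫ (mul.app X ⊗ₘ mul.app Y)
  unit_comul : ∀ X Y : C, unit.app (X ⊗ Y) ≫ oplax.δ X Y = unit.app X ⊗ₘ unit.app Y
  mul_counit : mul.app (𝟙_ C) ≫ oplax.η = T.map oplax.η ≫ oplax.η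
  unit_counit : unit.app (𝟙_ C) ≫ oplax.η = 𝟙 (𝟙_ C)

namespace BimonadOn

variable {C : Type u} [Category.{v} C] [MonoidalCategory C] {T : C ⥤ C} (B : BimonadOn T)

/-- The underlying monad. -/
def toMonad : Monad C where
  toFunctor := T
  η := B.unit
  μ := B.mul
  assoc := B.mul_assoc
  left_unit := B.left_unit
  right_unit := B.right_unit

/-- The left fusion operator `T(X ⊗ TY) ⟶ TX ⊗ TTY ⟶ TX ⊗ TY`. -/
def leftFusion (X Y : C) : T.obj (X ⊗ T.obj Y) ⟶ T.obj X ⊗ T.obj Y :=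
  B.oplax.δ X (T.obj Y) ≫ T.obj X ◁ B.mul.app Y

/-- The right fusion operator `T(TX ⊗ Y) ⟶ TTX ⊗ TY ⟶ TX ⊗ TY`. -/
def rightFusion (X Y : C) : T.obj (T.obj X ⊗ Y) ⟶ T.obj X ⊗ T.obj Y :=
  B.oplax.δ (T.obj X) Y ≫ B.mul.app X ▷ T.obj Y

/-- A bimonad is left Hopf if its left fusion operator is invertible. -/
def IsLeftHopf : Prop := ∀ X Y : C, IsIso (B.leftFusion X Y)

/-- A bimonad is right Hopf if its right fusion operator is invertible. -/
def IsRightHopf : Prop := ∀ X Y : C, IsIso (B.rightFusion X Y)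

/-- A Hopf monad is a bimonad which is both left and right Hopf. -/
def IsHopf : Prop := B.IsLeftHopf ∧ B.IsRightHopf

/-- The functor from `D` to the Eilenberg–Moore category of `T` over `U : D ⥤ C` given by a
natural action `θ` of `T` on the objects `U d`. -/
def toModules {D : Type*} [Category* D] (U : D ⥤ C) (θ : U ⋙ T ⟶ U)
    (hunit : ∀ d : D, B.unit.app (U.obj d) ≫ θ.app d = 𝟙 (U.obj d))
    (hmul : ∀ d : D, B.mul.app (U.obj d) ≫ θ.app d = T.map (θ.app d) ≫ θ.app d) :
    D ⥤ B.toMonad.Algebra where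
  obj d :=
    { A := U.obj d
      a := θ.app d
      unit := hunit d
      assoc := hmul d }
  map f :=
    { f := U.map f
      h := θ.naturality f }
  map_id d := by ext; exact U.map_id d
  map_comp f g := by ext; exact U.map_comp f g

end BimonadOn

/-! ### Insertion of duality morphisms

In this section `L` and `R` are two objects which will be specialised to `P, Q` or to `Q, P`. -/

namespace Sandwich

variable {C : Type u} [Category.{v} C] [MonoidalCategory C]

/-- The endofunctor `L ⊗ - ⊗ R`. -/
abbrev functor (L R : C) : C ⥤ C := tensorRight R ⋙ tensorLeft L

/-- `L R A ⟶ L (R A L) R`, inserting `𝟙 ⟶ L ⊗ R` on the right of `A`. -/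
def insertRight {L R : C} (cup : 𝟙_ C ⟶ L ⊗ R) (A : C) :
    L ⊗ (R ⊗ A) ⟶ L ⊗ ((R ⊗ (A ⊗ L)) ⊗ R) :=
  L ◁ R ◁ ((ρ_ A).inv ≫ A ◁ cup) ⊗≫ 𝟙 (L ⊗ ((R ⊗ (A ⊗ L)) ⊗ R))

/-- `A L R ⟶ L (R A L) R`, inserting `𝟙 ⟶ L ⊗ R` on the left of `A`. -/
def insertLeft {L R : C} (cup : 𝟙_ C ⟶ L ⊗ R) (A : C) :
    (A ⊗ L) ⊗ R ⟶ L ⊗ ((R ⊗ (A ⊗ L)) ⊗ R) :=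
  (((λ_ A).inv ≫ cup ▷ A) ▷ L) ▷ R ⊗≫ 𝟙 (L ⊗ ((R ⊗ (A ⊗ L)) ⊗ R))

/-- `L R A ⟶ A`, evaluating on the left of `A`. -/
def evalLeft {L R : C} (cap : L ⊗ R ⟶ 𝟙_ C) (A : C) : L ⊗ (R ⊗ A) ⟶ A :=
  (α_ L R A).inv ≫ cap ▷ A ≫ (λ_ A).hom

/-- `A L R ⟶ A`, evaluating on the right of `A`. -/
def evalRight {L R : C} (cap : L ⊗ R ⟶ 𝟙_ C) (A : C) : (A ⊗ L) ⊗ R ⟶ A :=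
  (α_ A L R).hom ≫ A ◁ cap ≫ (ρ_ A).hom

/-- `L (A B) R ⟶ (L A R) (L B R)`, inserting `𝟙 ⟶ R ⊗ L` between `A` and `B`. -/
def split {L R : C} (cup : 𝟙_ C ⟶ R ⊗ L) (A B : C) :
    L ⊗ ((A ⊗ B) ⊗ R) ⟶ (L ⊗ (A ⊗ R)) ⊗ (L ⊗ (B ⊗ R)) :=
  L ◁ ((A ◁ ((λ_ B).inv ≫ cup ▷ B)) ▷ R) ⊗≫ 𝟙 ((L ⊗ (A ⊗ R)) ⊗ (L ⊗ (B ⊗ R)))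

/-- `(L A R) B ⟶ L (A (R B L)) R`, inserting `𝟙 ⟶ L ⊗ R` on the right of `B`. -/
def absorbRight {L R : C} (cup : 𝟙_ C ⟶ L ⊗ R) (A B : C) :
    (L ⊗ (A ⊗ R)) ⊗ B ⟶ L ⊗ ((A ⊗ (R ⊗ (B ⊗ L))) ⊗ R) :=
  (L ⊗ (A ⊗ R)) ◁ ((ρ_ B).inv ≫ B ◁ cup) ⊗≫ 𝟙 (L ⊗ ((A ⊗ (R ⊗ (B ⊗ L))) ⊗ R))

/-- `A (L B R) ⟶ L ((R A L) B) R`, inserting `𝟙 ⟶ L ⊗ R` on the left of `A`. -/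
def absorbLeft {L R : C} (cup : 𝟙_ C ⟶ L ⊗ R) (A B : C) :
    A ⊗ (L ⊗ (B ⊗ R)) ⟶ L ⊗ (((R ⊗ (A ⊗ L)) ⊗ B) ⊗ R) :=
  ((λ_ A).inv ≫ cup ▷ A) ▷ (L ⊗ (B ⊗ R)) ⊗≫ 𝟙 (L ⊗ (((R ⊗ (A ⊗ L)) ⊗ B) ⊗ R))

theorem insertRight_naturality {L R : C} (cup : 𝟙_ C ⟶ L ⊗ R) {A B : C} (f : A ⟶ B) :
    L ◁ (R ◁ f) ≫ insertRight cup B = insertRight cup A ≫ L ◁ ((R ◁ (f ▷ L)) ▷ R) := by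
  have h : f ≫ (ρ_ B).inv ≫ B ◁ cup = ((ρ_ A).inv ≫ A ◁ cup) ≫ f ▷ (L ⊗ R) := by
    rw [Category.assoc, whisker_exchange, rightUnitor_inv_naturality_assoc]
  simp only [insertRight, monoidalComp, Category.comp_id]
  rw [← MonoidalCategory.whiskerLeft_comp_assoc, ← MonoidalCategory.whiskerLeft_comp, h]
  monoidal

theorem insertLeft_naturality {L R : C} (cup : 𝟙_ C ⟶ L ⊗ R) {A B : C} (f : A ⟶ B) :
    (f ▷ L) ▷ R ≫ insertLeft cup B = insertLeft cup A ≫ L ◁ ((R ◁ (f ▷ L)) ▷ R) := by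
  have h : f ≫ (λ_ B).inv ≫ cup ▷ B = ((λ_ A).inv ≫ cup ▷ A) ≫ (L ⊗ R) ◁ f := by
    rw [Category.assoc, ← whisker_exchange, leftUnitor_inv_naturality_assoc]
  simp only [insertLeft, monoidalComp, Category.comp_id]
  rw [← comp_whiskerRight_assoc, ← comp_whiskerRight, h]
  monoidal

theorem evalLeft_naturality {L R : C} (cap : L ⊗ R ⟶ 𝟙_ C) {A B : C} (f : A ⟶ B) :
    L ◁ (R ◁ f) ≫ evalLeft cap B = evalLeft cap A ≫ f := by
  simp only [evalLeft, Category.assoc, associator_inv_naturality_right_assoc,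
    whisker_exchange_assoc, leftUnitor_naturality]

theorem evalRight_naturality {L R : C} (cap : L ⊗ R ⟶ 𝟙_ C) {A B : C} (f : A ⟶ B) :
    (f ▷ L) ▷ R ≫ evalRight cap B = evalRight cap A ≫ f := by
  simp only [evalRight, Category.assoc, associator_naturality_left_assoc,
    ← whisker_exchange_assoc, rightUnitor_naturality]

end Sandwich

/-! ### Pivotal pairs -/

/-- A pivotal pair: `Q` is a left dual of `P` (via `coev : 𝟙 ⟶ P ⊗ Q`, `ev : Q ⊗ P ⟶ 𝟙`) and a
right dual of `P` (via `coev' : 𝟙 ⟶ Q ⊗ P`, `ev' : P ⊗ Q ⟶ 𝟙`), with chosen duality morphisms. -/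
structure PivotalPair (C : Type u) [Category.{v} C] [MonoidalCategory C] where
  P : C
  Q : C
  leftDual : ExactPairing P Q
  rightDual : ExactPairing Q P

/-- The two signs indexing `F₊ = Q ⊗ - ⊗ P` and `F₋ = P ⊗ - ⊗ Q`. -/
inductive PivSign
  | plus
  | minus

namespace PivSign

/-- The opposite sign. -/
def neg : PivSign → PivSign
  | plus => minus
  | minus => plus

/-- For `w = (i₁, …, iₙ)` this is the word `(-iₙ, …, -i₁)` followed by `v`. -/
def revNeg : List PivSign → List PivSign → List PivSign
  | [], v => v
  | i :: w, v => revNeg w (i.neg :: v)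

end PivSign

/-- The four kinds of parallel pairs, named after the two objects being evaluated and the side
on which they stand. -/
inductive PivKind
  | leftPQ
  | rightPQ
  | leftQP
  | rightQP

namespace PivKind

/-- The first letter of the two-letter word attached to a kind of parallel pair. -/
def sign : PivKind → PivSign
  | leftPQ => .minus
  | rightPQ => .minus
  | leftQP => .plus
  | rightQP => .plus

end PivKind

/-- Index set of the relations: the kind `k` of the pair, the word `u` of functors applied to the
pair, and the word `w` to whose functor the pair is attached. -/
structure PivRel where
  kind : PivKind
  outer : List PivSign
  inner : List PivSign

/-- The shape of the diagram: one object per word of signs, and one parallel pair per relation. -/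
def pivShape : MultispanShape.{0, 0} where
  L := PivRel
  R := List PivSign
  fst r := r.outer ++ (r.kind.sign :: r.kind.sign.neg :: r.inner)
  snd r := r.outer ++ r.inner

namespace PivotalPair

open PivSign

variable {C : Type u} [Category.{v} C] [MonoidalCategory C] (p : PivotalPair C)

/-- `coev : 𝟙 ⟶ P ⊗ Q` -/
def coevL : 𝟙_ C ⟶ p.P ⊗ p.Q := p.leftDual.coevaluation'

/-- `ev : Q ⊗ P ⟶ 𝟙` -/
def evL : p.Q ⊗ p.P ⟶ 𝟙_ C := p.leftDual.evaluation'

/-- `coev' : 𝟙 ⟶ Q ⊗ P` -/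
def coevR : 𝟙_ C ⟶ p.Q ⊗ p.P := p.rightDual.coevaluation'

/-- `ev' : P ⊗ Q ⟶ 𝟙` -/
def evR : p.P ⊗ p.Q ⟶ 𝟙_ C := p.rightDual.evaluation'

/-! #### The category of intertwined objects -/

/-- The morphism `Q ⊗ X ⟶ X ⊗ Q` induced by `σ : X ⊗ P ⟶ P ⊗ X`. -/
def bar {X : C} (σ : X ⊗ p.P ⟶ p.P ⊗ X) : p.Q ⊗ X ⟶ X ⊗ p.Q :=
  p.Q ◁ ((ρ_ X).inv ≫ X ◁ p.coevL) ⊗≫ (p.Q ◁ (σ ▷ p.Q)) ⊗≫ (p.evL ▷ (X ⊗ p.Q)) ≫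
    (λ_ (X ⊗ p.Q)).hom

/-- The morphism `X ⊗ Q ⟶ Q ⊗ X` induced by `τ : P ⊗ X ⟶ X ⊗ P`. -/
def barInv {X : C} (τ : p.P ⊗ X ⟶ X ⊗ p.P) : X ⊗ p.Q ⟶ p.Q ⊗ X :=
  ((λ_ X).inv ≫ p.coevR ▷ X) ▷ p.Q ⊗≫ (p.Q ◁ (τ ▷ p.Q)) ⊗≫ ((p.Q ⊗ X) ◁ p.evR) ≫
    (ρ_ (p.Q ⊗ X)).hom

/-- Objects of `C(P,Q)`: an object with an invertible `σ : X ⊗ P ⟶ P ⊗ X` such that the morphisms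
`Q ⊗ X ⟶ X ⊗ Q` and `X ⊗ Q ⟶ Q ⊗ X` induced by `σ` and `σ⁻¹` are inverse to each other. -/
structure Intertwined where
  X : C
  σ : X ⊗ p.P ≅ p.P ⊗ X
  bar_barInv : p.bar σ.hom ≫ p.barInv σ.inv = 𝟙 (p.Q ⊗ X)
  barInv_bar : p.barInv σ.inv ≫ p.bar σ.hom = 𝟙 (X ⊗ p.Q)

namespace Intertwined

variable {p}

/-- Morphisms of `C(P,Q)`. -/
@[ext]
structure Hom (A B : p.Intertwined) where
  f : A.X ⟶ B.X
  comm : f ▷ p.P ≫ B.σ.hom = A.σ.hom ≫ p.P ◁ f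

instance : Category.{v} p.Intertwined where
  Hom A B := Hom A B
  id A := { f := 𝟙 A.X, comm := by simp }
  comp f g := { f := f.f ≫ g.f, comm := by
                  rw [comp_whiskerRight, Category.assoc, g.comm, ← Category.assoc, f.comm,
                    Category.assoc, ← MonoidalCategory.whiskerLeft_comp] }
  id_comp f := by apply Hom.ext; exact Category.id_comp _
  comp_id f := by apply Hom.ext; exact Category.comp_id _
  assoc f g h := by apply Hom.ext; exact Category.assoc _ _ _

end Intertwined

/-- The forgetful functor `C(P,Q) ⥤ C`. -/
def forget : p.Intertwined ⥤ C where
  obj A := A.X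
  map f := f.f
  map_id _ := rfl
  map_comp _ _ := rfl

/-! #### The iterated functors -/

/-- `F₊ = Q ⊗ - ⊗ P` and `F₋ = P ⊗ - ⊗ Q`. -/
def F : PivSign → C ⥤ C
  | plus => Sandwich.functor p.Q p.P
  | minus => Sandwich.functor p.P p.Q

/-- `F_{i₁, …, iₙ} = F_{i₁} ∘ ⋯ ∘ F_{iₙ}`, where `i₁` is the outermost functor. -/
def word : List PivSign → (C ⥤ C)
  | [] => 𝟭 C
  | i :: w => word w ⋙ p.F i

/-- The canonical identification `F_u (F_w X) = F_{uw} X`. -/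
def append : ∀ u w : List PivSign, p.word w ⋙ p.word u ⟶ p.word (u ++ w)
  | [], w => (p.word w).rightUnitor.hom
  | i :: u, w =>
    (Functor.associator (p.word w) (p.word u) (p.F i)).inv ≫
      Functor.whiskerRight (append u w) (p.F i)

/-- The source of a parallel pair: `P Q A`, `A P Q`, `Q P A` or `A Q P`. -/
def src : PivKind → C ⥤ C
  | .leftPQ => tensorLeft p.Q ⋙ tensorLeft p.P
  | .rightPQ => tensorRight p.P ⋙ tensorRight p.Q
  | .leftQP => tensorLeft p.P ⋙ tensorLeft p.Q
  | .rightQP => tensorRight p.Q ⋙ tensorRight p.P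

/-- The first morphism of a parallel pair: insertion of a coevaluation, with values in
`F₋ F₊ A` or in `F₊ F₋ A`. -/
def insertApp : ∀ (k : PivKind) (A : C), (p.src k).obj A ⟶ (p.F k.sign).obj ((p.F k.sign.neg).obj A)
  | .leftPQ, A => Sandwich.insertRight p.coevL A
  | .rightPQ, A => Sandwich.insertLeft p.coevL A
  | .leftQP, A => Sandwich.insertRight p.coevR A
  | .rightQP, A => Sandwich.insertLeft p.coevR A

/-- The second morphism of a parallel pair: an evaluation. -/
def evalApp : ∀ (k : PivKind) (A : C), (p.src k).obj A ⟶ A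
  | .leftPQ, A => Sandwich.evalLeft p.evR A
  | .rightPQ, A => Sandwich.evalRight p.evR A
  | .leftQP, A => Sandwich.evalLeft p.evL A
  | .rightQP, A => Sandwich.evalRight p.evL A

theorem insertApp_naturality (k : PivKind) {A B : C} (f : A ⟶ B) :
    (p.src k).map f ≫ p.insertApp k B =
      p.insertApp k A ≫ (p.F k.sign).map ((p.F k.sign.neg).map f) := by
  cases k
  · exact Sandwich.insertRight_naturality p.coevL f
  · exact Sandwich.insertLeft_naturality p.coevL f
  · exact Sandwich.insertRight_naturality p.coevR f
  · exact Sandwich.insertLeft_naturality p.coevR f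

theorem evalApp_naturality (k : PivKind) {A B : C} (f : A ⟶ B) :
    (p.src k).map f ≫ p.evalApp k B = p.evalApp k A ≫ f := by
  cases k
  · exact Sandwich.evalLeft_naturality p.evR f
  · exact Sandwich.evalRight_naturality p.evR f
  · exact Sandwich.evalLeft_naturality p.evL f
  · exact Sandwich.evalRight_naturality p.evL f

/-- Insertion of a coevaluation as a natural transformation. -/
def insertNat (k : PivKind) : p.src k ⟶ p.F k.sign.neg ⋙ p.F k.sign where
  app A := p.insertApp k A
  naturality _ _ f := p.insertApp_naturality k f

/-- Evaluation as a natural transformation. -/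
def evalNat (k : PivKind) : p.src k ⟶ 𝟭 C where
  app A := p.evalApp k A
  naturality _ _ f := p.evalApp_naturality k f

/-- The diagram in `End(C)`: the objects `F_w` for all words `w`, and for each of the four kinds of
parallel pairs attached to `F_w` and each word `u` the image under `F_u` of this pair, i.e. the pair
`F_u (src F_w) ⟶ F_u (F_± F_∓ F_w) = F_{u,±,∓,w}` and `F_u (src F_w) ⟶ F_u F_w = F_{u,w}`. -/
def index : MultispanIndex pivShape (C ⥤ C) where
  left r := p.word r.inner ⋙ p.src r.kind ⋙ p.word r.outer
  right w := p.word w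
  fst r :=
    Functor.whiskerLeft (p.word r.inner) (Functor.whiskerRight (p.insertNat r.kind) (p.word r.outer)) ≫
      p.append r.outer (r.kind.sign :: r.kind.sign.neg :: r.inner)
  snd r :=
    Functor.whiskerLeft (p.word r.inner) (Functor.whiskerRight (p.evalNat r.kind) (p.word r.outer)) ≫
      p.append r.outer r.inner

/-! #### The functor `T` and the formulas for its structure -/

section T

variable [∀ X : C, HasColimit (p.index.multispan.flip.obj X)]

/-- The endofunctor `T`: the colimit of the diagram in `End(C)`, which exists and is computed
objectwise as soon as the diagrams of the objects `F_w(X)` have colimits in `C`. -/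
noncomputable def T : C ⥤ C := multicoequalizer p.index

/-- The canonical natural transformations `ψ_w : F_w ⟶ T`. -/
noncomputable def ψ (w : List PivSign) : p.word w ⟶ p.T := Multicoequalizer.π p.index w

end T

/-- The actions `Q ⊗ X ⊗ P ⟶ X` and `P ⊗ X ⊗ Q ⟶ X` induced by an intertwining. -/
def action (A : p.Intertwined) : ∀ i : PivSign, (p.F i).obj A.X ⟶ A.X
  | plus => p.Q ◁ A.σ.hom ≫ Sandwich.evalLeft p.evL A.X
  | minus => (α_ p.P A.X p.Q).inv ≫ A.σ.inv ▷ p.Q ≫ Sandwich.evalRight p.evR A.X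

/-- The iterated action `F_w X ⟶ X` of an intertwined object. -/
def iterAction (A : p.Intertwined) : ∀ w : List PivSign, (p.word w).obj A.X ⟶ A.X
  | [] => 𝟙 A.X
  | i :: w => (p.F i).map (iterAction A w) ≫ p.action A i

/-- `ev_+ = ev` and `ev_- = ev'`, as morphisms `F_±(𝟙) ⟶ 𝟙`. -/
def evSign : ∀ i : PivSign, (p.F i).obj (𝟙_ C) ⟶ 𝟙_ C
  | plus => p.Q ◁ (λ_ p.P).hom ≫ p.evL
  | minus => p.P ◁ (λ_ p.Q).hom ≫ p.evR

/-- The iterated evaluations `F_w(𝟙) ⟶ 𝟙`. -/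
def evWord : ∀ w : List PivSign, (p.word w).obj (𝟙_ C) ⟶ 𝟙_ C
  | [] => 𝟙 (𝟙_ C)
  | i :: w => (p.F i).map (evWord w) ≫ p.evSign i

/-- `F_±(A ⊗ B) ⟶ F_±(A) ⊗ F_±(B)`, inserting `coev` (for `+`) or `coev'` (for `-`). -/
def splitSign : ∀ (i : PivSign) (A B : C), (p.F i).obj (A ⊗ B) ⟶ (p.F i).obj A ⊗ (p.F i).obj B
  | plus, A, B => Sandwich.split p.coevL A B
  | minus, A, B => Sandwich.split p.coevR A B

/-- `F_w(X ⊗ coev_w ⊗ Y) : F_w(X ⊗ Y) ⟶ F_w(X) ⊗ F_w(Y)` for the iterated coevaluation `coev_w`. -/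
def splitWord : ∀ (w : List PivSign) (X Y : C),
    (p.word w).obj (X ⊗ Y) ⟶ (p.word w).obj X ⊗ (p.word w).obj Y
  | [], X, Y => 𝟙 (X ⊗ Y)
  | i :: w, X, Y => (p.F i).map (splitWord w X Y) ≫
      p.splitSign i ((p.word w).obj X) ((p.word w).obj Y)

/-- `F_±(A) ⊗ B ⟶ F_±(A ⊗ F_∓(B))`, inserting `coev_∓` on the right. -/
def absorbRightSign : ∀ (i : PivSign) (A B : C),
    (p.F i).obj A ⊗ B ⟶ (p.F i).obj (A ⊗ (p.F i.neg).obj B)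
  | plus, A, B => Sandwich.absorbRight p.coevR A B
  | minus, A, B => Sandwich.absorbRight p.coevL A B

/-- For `w = (i₁, …, iₙ)`, the insertion of `coev_{-iₙ, …, -i₁}` on the right:
`F_w(X) ⊗ F_v(Y) ⟶ F_w(X ⊗ F_{-iₙ, …, -i₁, v}(Y))`. -/
def absorbRightWord : ∀ (w v : List PivSign) (X Y : C),
    (p.word w).obj X ⊗ (p.word v).obj Y ⟶ (p.word w).obj (X ⊗ (p.word (revNeg w v)).obj Y)
  | [], v, X, Y => 𝟙 (X ⊗ (p.word v).obj Y)
  | i :: w, v, X, Y => p.absorbRightSign i ((p.word w).obj X) ((p.word v).obj Y) ≫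
      (p.F i).map (absorbRightWord w (i.neg :: v) X Y)

/-- `A ⊗ F_±(B) ⟶ F_±(F_∓(A) ⊗ B)`, inserting `coev_∓` on the left. -/
def absorbLeftSign : ∀ (i : PivSign) (A B : C),
    A ⊗ (p.F i).obj B ⟶ (p.F i).obj ((p.F i.neg).obj A ⊗ B)
  | plus, A, B => Sandwich.absorbLeft p.coevR A B
  | minus, A, B => Sandwich.absorbLeft p.coevL A B

/-- For `v = (j₁, …, jₘ)`, the insertion of `coev_{-jₘ, …, -j₁}` on the left:
`F_w(X) ⊗ F_v(Y) ⟶ F_v(F_{-jₘ, …, -j₁, w}(X) ⊗ Y)`. -/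
def absorbLeftWord : ∀ (w v : List PivSign) (X Y : C),
    (p.word w).obj X ⊗ (p.word v).obj Y ⟶ (p.word v).obj ((p.word (revNeg v w)).obj X ⊗ Y)
  | w, [], X, Y => 𝟙 ((p.word w).obj X ⊗ Y)
  | w, j :: v, X, Y => p.absorbLeftSign j ((p.word w).obj X) ((p.word v).obj Y) ≫
      (p.F j).map (absorbLeftWord (j.neg :: w) v X Y)

section Structure

variable [∀ X : C, HasColimit (p.index.multispan.flip.obj X)]

/-- The defining formulas for the bimonad structure `(μ, η, T₂, T₀)` of `T`. -/
structure IsStandard (B : BimonadOn p.T) : Prop where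
  unit_eq : B.unit = p.ψ []
  mul_eq : ∀ (w v : List PivSign) (X : C),
    (p.word w).map ((p.ψ v).app X) ≫ (p.ψ w).app (p.T.obj X) ≫ B.mul.app X =
      (p.append w v).app X ≫ (p.ψ (w ++ v)).app X
  comul_eq : ∀ (w : List PivSign) (X Y : C),
    (p.ψ w).app (X ⊗ Y) ≫ B.oplax.δ X Y =
      p.splitWord w X Y ≫ ((p.ψ w).app X ⊗ₘ (p.ψ w).app Y)
  counit_eq : ∀ w : List PivSign, (p.ψ w).app (𝟙_ C) ≫ B.oplax.η = p.evWord w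

/-- The formula characterising the inverse of the left fusion operator at `X, Y`. -/
def IsLeftInverseFormula (X Y : C) (G : p.T.obj X ⊗ p.T.obj Y ⟶ p.T.obj (X ⊗ p.T.obj Y)) : Prop :=
  ∀ w v : List PivSign, ((p.ψ w).app X ⊗ₘ (p.ψ v).app Y) ≫ G =
    p.absorbRightWord w v X Y ≫ (p.word w).map (X ◁ (p.ψ (revNeg w v)).app Y) ≫
      (p.ψ w).app (X ⊗ p.T.obj Y)

/-- The formula characterising the inverse of the right fusion operator at `X, Y`. -/
def IsRightInverseFormula (X Y : C) (G : p.T.obj X ⊗ p.T.obj Y ⟶ p.T.obj (p.T.obj X ⊗ Y)) : Prop :=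
  ∀ w v : List PivSign, ((p.ψ w).app X ⊗ₘ (p.ψ v).app Y) ≫ G =
    p.absorbLeftWord w v X Y ≫ (p.word v).map ((p.ψ (revNeg v w)).app X ▷ Y) ≫
      (p.ψ v).app (p.T.obj X ⊗ Y)

end Structure

end PivotalPair

/-! The proof rests on one notion: an object `Z` with morphisms `F_±(Z) ⟶ Z` that coequalize the
four parallel pairs (`SignAction`). By duality an action of `F₊` is a morphism `Z ⊗ P ⟶ P ⊗ Z`, and
an action of `F₋` is a morphism `P ⊗ Z ⟶ Z ⊗ P`. Their mates are morphisms `Q ⊗ Z ⟶ Z ⊗ Q` and `Z ⊗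
Q ⟶ Q ⊗ Z`. The four relations say exactly that these exchanges are inverse in pairs
(`exchAt_exchInvAt`, `exchInvAt_exchAt`, with converse `Compatible.of_exchAt`), so sign actions are
the same as intertwined objects. Exchanges past `Z` and past `W` compose to an exchange past `Z ⊗
W`, so sign actions have a tensor product and a unit (`Compatible.tensor`, `Compatible.unit`).

Next, `T(X)` is the free sign action on `X`. Since `F_i` preserves colimits and sends the relation
with outer word `u` to the one with outer word `i :: u`, it acts on `T(X)` (`exists_freeAct`). A
morphism `X ⟶ M` into a sign action extends uniquely along `ψ_∅` to an action morphism `T(X) ⟶ M`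
(`lift`, `isHom_lift`, `hom_ext`). Multiplication, comultiplication and counit are such extensions,
and each bimonad axiom compares two action morphisms with the same restriction along `ψ_∅`. The
formulas on `ψ_w` follow by induction on `w`, and they determine the structure because the `ψ_w` are
jointly epic, also after tensoring. A `T`-module restricts along `ψ_±` to a sign action, and `lift
(𝟙)` goes back.

For the Hopf property, let `Z` and `V` carry sign actions. A pairing `A ⊗ Z ⟶ V` transposes to
`F_±(A) ⊗ Z ⟶ V`: move the factor standing between `A` and `Z` past `Z`, pair, then act on `V`.
Transposition respects the parallel pairs (`insertRight_transposeRight` and its variants), so `ψ_∅ :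
X ⊗ Z ⟶ T(X ⊗ Z)` extends to `T(X) ⊗ Z ⟶ T(X ⊗ Z)`. For `Z = T(Y)` this inverts the left fusion
operator: one composite is the identity by freeness, the other by induction on words. The right
fusion operator is the mirror image. Only preservation of colimits by `⊗` is needed, not closedness.
-/

namespace Sandwich

/-! ### Exchange morphisms and their invertibility -/

variable {C : Type u} [Category.{v} C] [MonoidalCategory C] {L R Z W V A : C}

/-- Insertion of a coevaluation on the left of `X`, in right-nested form. -/
def cupAt (cup : 𝟙_ C ⟶ L ⊗ R) (X : C) : X ⟶ L ⊗ (R ⊗ X) :=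
  (λ_ X).inv ≫ cup ▷ X ≫ (α_ L R X).hom

/-- The morphism `a : L ⊗ Z ⊗ R ⟶ Z` applied on the left of `X`, in right-nested form. -/
def actAt (a : L ⊗ (Z ⊗ R) ⟶ Z) (X : C) : L ⊗ (Z ⊗ (R ⊗ X)) ⟶ Z ⊗ X :=
  L ◁ (α_ Z R X).inv ≫ (α_ L (Z ⊗ R) X).inv ≫ a ▷ X

/-- The morphism `g : A ⊗ Z ⟶ V` applied on the left of `X`, in right-nested form. -/
def pairAt (g : A ⊗ Z ⟶ V) (X : C) : A ⊗ (Z ⊗ X) ⟶ V ⊗ X :=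
  (α_ A Z X).inv ≫ g ▷ X

theorem cupAt_naturality (cup : 𝟙_ C ⟶ L ⊗ R) {X Y : C} (h : X ⟶ Y) :
    h ≫ cupAt cup Y = cupAt cup X ≫ L ◁ R ◁ h := by
  rw [cupAt, leftUnitor_inv_naturality_assoc, whisker_exchange_assoc]
  simp [cupAt]

theorem capAt_naturality (cap : L ⊗ R ⟶ 𝟙_ C) {X Y : C} (h : X ⟶ Y) :
    L ◁ R ◁ h ≫ evalLeft cap Y = evalLeft cap X ≫ h :=
  evalLeft_naturality cap h

theorem actAt_naturality (a : L ⊗ (Z ⊗ R) ⟶ Z) {X Y : C} (h : X ⟶ Y) :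
    L ◁ Z ◁ R ◁ h ≫ actAt a Y = actAt a X ≫ Z ◁ h := by
  simp only [actAt, Category.assoc, ← whisker_exchange]
  monoidal

theorem pairAt_naturality (g : A ⊗ Z ⟶ V) {X Y : C} (h : X ⟶ Y) :
    A ◁ Z ◁ h ≫ pairAt g Y = pairAt g X ≫ V ◁ h := by
  simp only [pairAt, Category.assoc, ← whisker_exchange]
  monoidal

/-- This and the next lemma are the two zigzag identities of the duality, with a spectator `X` on
the right. Keeping a spectator makes all composites right-nested, so that later arguments are chains
of rewrites. -/
theorem cupAt_evalLeft (d : ExactPairing L R) (X : C) :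
    cupAt d.coevaluation' (L ⊗ X) ≫ L ◁ evalLeft d.evaluation' X = 𝟙 (L ⊗ X) := by
  have h := d.evaluation_coevaluation'
  calc _ = 𝟙 _ ⊗≫ (d.coevaluation' ▷ L ≫ (α_ L R L).hom ≫ L ◁ d.evaluation') ▷ X ⊗≫ 𝟙 _ := by
        simp only [cupAt, evalLeft]; monoidal
    _ = _ := by rw [h]; monoidal

theorem whiskerLeft_cupAt_evalLeft (d : ExactPairing L R) (X : C) :
    R ◁ cupAt d.coevaluation' X ≫ evalLeft d.evaluation' (R ⊗ X) = 𝟙 (R ⊗ X) := by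
  have h := d.coevaluation_evaluation'
  calc _ = 𝟙 _ ⊗≫ (R ◁ d.coevaluation' ≫ (α_ R L R).inv ≫ d.evaluation' ▷ R) ▷ X ⊗≫ 𝟙 _ := by
        simp only [cupAt, evalLeft]; monoidal
    _ = _ := by rw [h]; monoidal

/-- The relations between morphisms `a : L ⊗ Z ⊗ R ⟶ Z` and `b : R ⊗ Z ⊗ L ⟶ Z` imposed by the
two parallel pairs with target `L ⊗ (R ⊗ Z ⊗ L) ⊗ R`. -/
structure Compatible (d : ExactPairing L R) (d' : ExactPairing R L) (a : L ⊗ (Z ⊗ R) ⟶ Z)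
    (b : R ⊗ (Z ⊗ L) ⟶ Z) : Prop where
  left : insertRight d.coevaluation' Z ≫ L ◁ (b ▷ R) ≫ a = evalLeft d'.evaluation' Z
  right : insertLeft d.coevaluation' Z ≫ L ◁ (b ▷ R) ≫ a = evalRight d'.evaluation' Z

variable {d : ExactPairing L R} {d' : ExactPairing R L} {a : L ⊗ (Z ⊗ R) ⟶ Z}
  {b : R ⊗ (Z ⊗ L) ⟶ Z}

theorem eq_of_whiskerRight_unit {X Y : C} {f g : X ⟶ Y} (h : f ▷ 𝟙_ C = g ▷ 𝟙_ C) : f = g := by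
  simpa using h

theorem Compatible.leftAt (h : Compatible d d' a b) (X : C) :
    L ◁ R ◁ Z ◁ cupAt d.coevaluation' X ≫ L ◁ actAt b (R ⊗ X) ≫ actAt a X =
      evalLeft d'.evaluation' (Z ⊗ X) := by
  calc _ = 𝟙 _ ⊗≫ (insertRight d.coevaluation' Z ≫ L ◁ (b ▷ R) ≫ a) ▷ X ⊗≫ 𝟙 _ := by
        simp only [cupAt, actAt, insertRight]; monoidal
    _ = _ := by rw [h.left]; simp only [evalLeft]; monoidal

theorem Compatible.rightAt (h : Compatible d d' a b) (X : C) :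
    cupAt d.coevaluation' (Z ⊗ (L ⊗ (R ⊗ X))) ≫ L ◁ actAt b (R ⊗ X) ≫ actAt a X =
      Z ◁ evalLeft d'.evaluation' X := by
  calc _ = 𝟙 _ ⊗≫ (insertLeft d.coevaluation' Z ≫ L ◁ (b ▷ R) ≫ a) ▷ X ⊗≫ 𝟙 _ := by
        simp only [cupAt, actAt, insertLeft]; monoidal
    _ = _ := by rw [h.right]; simp only [evalLeft, evalRight]; monoidal

/-- The spectator `𝟙_ C` suffices, since tensoring with the unit is faithful. -/
theorem Compatible.of_at
    (hl : L ◁ R ◁ Z ◁ cupAt d.coevaluation' (𝟙_ C) ≫ L ◁ actAt b (R ⊗ 𝟙_ C) ≫ actAt a (𝟙_ C) =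
      evalLeft d'.evaluation' (Z ⊗ 𝟙_ C))
    (hr : cupAt d.coevaluation' (Z ⊗ (L ⊗ (R ⊗ 𝟙_ C))) ≫ L ◁ actAt b (R ⊗ 𝟙_ C) ≫
      actAt a (𝟙_ C) = Z ◁ evalLeft d'.evaluation' (𝟙_ C)) : Compatible d d' a b where
  left := by
    calc _ = 𝟙 _ ⊗≫ (L ◁ R ◁ Z ◁ cupAt d.coevaluation' (𝟙_ C) ≫ L ◁ actAt b (R ⊗ 𝟙_ C) ≫
          actAt a (𝟙_ C)) ⊗≫ 𝟙 _ := by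
          simp only [cupAt, actAt, insertRight]; monoidal
      _ = _ := by rw [hl]; simp only [evalLeft]; monoidal
  right := by
    calc _ = 𝟙 _ ⊗≫ (cupAt d.coevaluation' (Z ⊗ (L ⊗ (R ⊗ 𝟙_ C))) ≫ L ◁ actAt b (R ⊗ 𝟙_ C) ≫
          actAt a (𝟙_ C)) ⊗≫ 𝟙 _ := by
          simp only [cupAt, actAt, insertLeft]; monoidal
      _ = _ := by rw [hr]; simp only [evalLeft, evalRight]; monoidal

/-- The exchange `Z ⊗ R ⟶ R ⊗ Z` induced by `a : L ⊗ Z ⊗ R ⟶ Z`. -/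
def exchAt (d' : ExactPairing R L) (a : L ⊗ (Z ⊗ R) ⟶ Z) (X : C) :
    Z ⊗ (R ⊗ X) ⟶ R ⊗ (Z ⊗ X) :=
  cupAt d'.coevaluation' (Z ⊗ (R ⊗ X)) ≫ R ◁ actAt a X

/-- The exchange `R ⊗ Z ⟶ Z ⊗ R` induced by `b : R ⊗ Z ⊗ L ⟶ Z`. -/
def exchInvAt (d : ExactPairing L R) (b : R ⊗ (Z ⊗ L) ⟶ Z) (X : C) :
    R ⊗ (Z ⊗ X) ⟶ Z ⊗ (R ⊗ X) :=
  R ◁ Z ◁ cupAt d.coevaluation' X ≫ actAt b (R ⊗ X)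

theorem exchAt_naturality {X Y : C} (h : X ⟶ Y) :
    Z ◁ R ◁ h ≫ exchAt d' a Y = exchAt d' a X ≫ R ◁ Z ◁ h := by
  simp only [exchAt, Category.assoc, reassoc_of% cupAt_naturality, ← MonoidalCategory.whiskerLeft_comp,
    actAt_naturality]

theorem exchInvAt_naturality {X Y : C} (h : X ⟶ Y) :
    R ◁ Z ◁ h ≫ exchInvAt d b Y = exchInvAt d b X ≫ Z ◁ R ◁ h := by
  rw [exchInvAt, exchInvAt, Category.assoc, ← actAt_naturality]
  simp only [← MonoidalCategory.whiskerLeft_comp_assoc, ← MonoidalCategory.whiskerLeft_comp,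
    cupAt_naturality]

/-- The coevaluation inserted by the second exchange slides ahead of the first action. The relation
with insertion on the left then turns both actions into an evaluation to the right of `Z`, which a
zigzag cancels. -/
theorem exchAt_exchInvAt (h : Compatible d' d b a) (X : C) :
    exchAt d' a X ≫ exchInvAt d b X = 𝟙 (Z ⊗ (R ⊗ X)) := by
  simp only [exchAt, exchInvAt, Category.assoc]
  rw [← MonoidalCategory.whiskerLeft_comp_assoc, ← actAt_naturality,
    MonoidalCategory.whiskerLeft_comp_assoc, ← reassoc_of% cupAt_naturality, h.rightAt,
    ← MonoidalCategory.whiskerLeft_comp, whiskerLeft_cupAt_evalLeft,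
    MonoidalCategory.whiskerLeft_id]

/-- Here the relation with insertion on the right produces an evaluation to the left of `Z`,
cancelled by the other zigzag. The compatibility used is the one with `L` and `R` in the opposite
roles to those in `exchAt_exchInvAt`. -/
theorem exchInvAt_exchAt (h : Compatible d d' a b) (X : C) :
    exchInvAt d b X ≫ exchAt d' a X = 𝟙 (R ⊗ (Z ⊗ X)) := by
  simp only [exchAt, exchInvAt, Category.assoc]
  rw [reassoc_of% cupAt_naturality, reassoc_of% cupAt_naturality, ← MonoidalCategory.whiskerLeft_comp,
    ← MonoidalCategory.whiskerLeft_comp, h.leftAt, cupAt_evalLeft]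

/-- Acting is exchanging followed by evaluating. -/
theorem whiskerLeft_exchAt_evalLeft (X : C) :
    L ◁ exchAt d' a X ≫ evalLeft d'.evaluation' (Z ⊗ X) = actAt a X := by
  rw [exchAt, MonoidalCategory.whiskerLeft_comp_assoc, capAt_naturality,
    reassoc_of% whiskerLeft_cupAt_evalLeft]

theorem exchInvAt_whiskerLeft_evalLeft (X : C) :
    exchInvAt d b (L ⊗ X) ≫ Z ◁ evalLeft d.evaluation' X = actAt b X := by
  rw [exchInvAt, Category.assoc, ← actAt_naturality, ← MonoidalCategory.whiskerLeft_comp_assoc,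
    ← MonoidalCategory.whiskerLeft_comp, cupAt_evalLeft]
  simp

/-- Exchanging `Z` with `L ⊗ R` is compatible with coevaluation. -/
theorem whiskerLeft_cupAt_exchAt (h : Compatible d d' a b) (X : C) :
    Z ◁ cupAt d.coevaluation' X ≫ exchAt d b (R ⊗ X) ≫ L ◁ exchAt d' a X =
      cupAt d.coevaluation' (Z ⊗ X) := by
  rw [exchAt, Category.assoc, reassoc_of% cupAt_naturality, ← MonoidalCategory.whiskerLeft_comp,
    ← MonoidalCategory.whiskerLeft_comp, ← Category.assoc (R ◁ _), ← exchInvAt,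
    exchInvAt_exchAt h, MonoidalCategory.whiskerLeft_id, Category.comp_id]

/-- Exchanging `Z` with `L ⊗ R` is compatible with evaluation. -/
theorem exchAt_exchAt_evalLeft (h : Compatible d d' a b) (X : C) :
    exchAt d b (R ⊗ X) ≫ L ◁ exchAt d' a X ≫ evalLeft d'.evaluation' (Z ⊗ X) =
      Z ◁ evalLeft d'.evaluation' X := by
  rw [whiskerLeft_exchAt_evalLeft, exchAt, Category.assoc, h.rightAt]

/-- Inverting both exchanges in `whiskerLeft_cupAt_exchAt` requires the relations for both signs. -/
theorem cupAt_exchInvAt (h : Compatible d d' a b) (h' : Compatible d' d b a) (X : C) :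
    cupAt d.coevaluation' (Z ⊗ X) ≫ L ◁ exchInvAt d b X ≫ exchInvAt d' a (R ⊗ X) =
      Z ◁ cupAt d.coevaluation' X := by
  rw [← whiskerLeft_cupAt_exchAt h, Category.assoc, Category.assoc,
    ← MonoidalCategory.whiskerLeft_comp_assoc, exchAt_exchInvAt h',
    MonoidalCategory.whiskerLeft_id, Category.id_comp, exchAt_exchInvAt h, Category.comp_id]

theorem exchInvAt_exchInvAt_evalLeft (h : Compatible d d' a b) (h' : Compatible d' d b a) (X : C) :
    L ◁ exchInvAt d b X ≫ exchInvAt d' a (R ⊗ X) ≫ Z ◁ evalLeft d'.evaluation' X =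
      evalLeft d'.evaluation' (Z ⊗ X) := by
  rw [← exchAt_exchAt_evalLeft h, reassoc_of% exchInvAt_exchAt h',
    ← MonoidalCategory.whiskerLeft_comp_assoc, exchInvAt_exchAt h,
    MonoidalCategory.whiskerLeft_id, Category.id_comp]

end Sandwich

/-! ### Tensor product and unit of actions -/

namespace Sandwich

variable {C : Type u} [Category.{v} C] [MonoidalCategory C] {L R Z W V A : C}

/-- The action on a tensor product. -/
def tensorAct (d' : ExactPairing R L) (a : L ⊗ (Z ⊗ R) ⟶ Z) (a' : L ⊗ (W ⊗ R) ⟶ W) :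
    L ⊗ ((Z ⊗ W) ⊗ R) ⟶ Z ⊗ W :=
  split d'.coevaluation' Z W ≫ (a ⊗ₘ a')

/-- The action on the unit object. -/
def unitAct (d' : ExactPairing R L) : L ⊗ (𝟙_ C ⊗ R) ⟶ 𝟙_ C :=
  L ◁ (λ_ R).hom ≫ d'.evaluation'

variable {d : ExactPairing L R} {d' : ExactPairing R L}

/-- The coevaluation inserted between `Z` and `W` together with `a'` is the exchange of `W` with
`R`. What remains is the action on `Z` alone. -/
theorem actAt_tensorAct (a : L ⊗ (Z ⊗ R) ⟶ Z) (a' : L ⊗ (W ⊗ R) ⟶ W) (X : C) :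
    actAt (tensorAct d' a a') X = L ◁ (α_ Z W (R ⊗ X)).hom ≫ L ◁ Z ◁ exchAt d' a' X ≫
      actAt a (W ⊗ X) ≫ (α_ Z W X).inv := by
  simp only [actAt, tensorAct, exchAt, cupAt, split, tensorHom_def']
  monoidal

theorem actAt_unitAct (X : C) :
    actAt (unitAct d') X =
      L ◁ (λ_ (R ⊗ X)).hom ≫ evalLeft d'.evaluation' X ≫ (λ_ X).inv := by
  simp only [actAt, unitAct, evalLeft]
  monoidal

theorem Compatible.unit : Compatible d d' (unitAct d') (unitAct d) := by
  apply Compatible.of_at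
  · simp only [actAt_unitAct, MonoidalCategory.whiskerLeft_comp, Category.assoc]
    have h : (𝟙_ C) ◁ cupAt d.coevaluation' (𝟙_ C) ≫ (λ_ (L ⊗ (R ⊗ 𝟙_ C))).hom =
      (λ_ _).hom ≫ cupAt d.coevaluation' (𝟙_ C) := by simp
    rw [← MonoidalCategory.whiskerLeft_comp_assoc L (R ◁ _),
      ← MonoidalCategory.whiskerLeft_comp R, h]
    simp only [MonoidalCategory.whiskerLeft_comp, Category.assoc,
      ← MonoidalCategory.whiskerLeft_comp_assoc L (λ_ _).inv, Iso.inv_hom_id,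
      MonoidalCategory.whiskerLeft_id, Category.id_comp]
    rw [← MonoidalCategory.whiskerLeft_comp_assoc L (R ◁ cupAt _ _), whiskerLeft_cupAt_evalLeft,
      MonoidalCategory.whiskerLeft_id, Category.id_comp, reassoc_of% capAt_naturality]
    simp
  · simp only [actAt_unitAct, MonoidalCategory.whiskerLeft_comp, Category.assoc]
    rw [← reassoc_of% cupAt_naturality]
    simp only [← MonoidalCategory.whiskerLeft_comp_assoc L (λ_ _).inv, Iso.inv_hom_id,
      MonoidalCategory.whiskerLeft_id, Category.id_comp]
    rw [reassoc_of% cupAt_evalLeft]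
    simp

/-- The exchanges past `W` carry a coevaluation, respectively an evaluation, from one side of `W` to
the other. This reduces each relation for `Z ⊗ W` to the one for `Z`. -/
theorem Compatible.tensor {a : L ⊗ (Z ⊗ R) ⟶ Z} {b : R ⊗ (Z ⊗ L) ⟶ Z}
    {a' : L ⊗ (W ⊗ R) ⟶ W} {b' : R ⊗ (W ⊗ L) ⟶ W} (h : Compatible d d' a b)
    (h' : Compatible d d' a' b') : Compatible d d' (tensorAct d' a a') (tensorAct d b b') := by
  apply Compatible.of_at
  · simp only [actAt_tensorAct, MonoidalCategory.whiskerLeft_comp, Category.assoc]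
    have e : (Z ⊗ W) ◁ cupAt d.coevaluation' (𝟙_ C) ≫ (α_ Z W _).hom =
      (α_ Z W _).hom ≫ Z ◁ W ◁ cupAt d.coevaluation' (𝟙_ C) := by simp
    have e1 := congrArg (fun t => L ◁ R ◁ t) e
    have e2 := congrArg (fun t => L ◁ R ◁ Z ◁ t) (whiskerLeft_cupAt_exchAt h' (𝟙_ C))
    have e3 := congrArg (fun t => L ◁ t) (actAt_naturality b (exchAt d' a' (𝟙_ C)))
    simp only [MonoidalCategory.whiskerLeft_comp] at e1 e2 e3
    rw [reassoc_of% e1]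
    simp only [← MonoidalCategory.whiskerLeft_comp_assoc L (α_ _ _ _).inv, Iso.inv_hom_id,
      MonoidalCategory.whiskerLeft_id, Category.id_comp]
    rw [← reassoc_of% e3, reassoc_of% e2, reassoc_of% h.leftAt, reassoc_of% capAt_naturality]
    simp
  · simp only [actAt_tensorAct, MonoidalCategory.whiskerLeft_comp, Category.assoc]
    have e3 := congrArg (fun t => L ◁ t) (actAt_naturality b (exchAt d' a' (𝟙_ C)))
    simp only [MonoidalCategory.whiskerLeft_comp] at e3
    simp only [← MonoidalCategory.whiskerLeft_comp_assoc L (α_ _ _ _).inv, Iso.inv_hom_id,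
      MonoidalCategory.whiskerLeft_id, Category.id_comp]
    rw [← reassoc_of% e3, ← reassoc_of% cupAt_naturality, ← reassoc_of% cupAt_naturality,
      ← reassoc_of% cupAt_naturality, reassoc_of% h.rightAt, ← MonoidalCategory.whiskerLeft_comp_assoc Z,
      ← MonoidalCategory.whiskerLeft_comp_assoc Z, Category.assoc, exchAt_exchAt_evalLeft h']
    simp

/-! ### Transposition of pairings -/

/-- The pairing `(L ⊗ A ⊗ R) ⊗ Z ⟶ V` induced by a pairing `A ⊗ Z ⟶ V` and actions on `Z`
and `V`. -/
def transposeRight (d : ExactPairing L R) (b : R ⊗ (Z ⊗ L) ⟶ Z) (c : L ⊗ (V ⊗ R) ⟶ V)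
    (g : A ⊗ Z ⟶ V) : (L ⊗ (A ⊗ R)) ⊗ Z ⟶ V :=
  absorbRight d.coevaluation' A Z ≫ L ◁ ((A ◁ b ≫ g) ▷ R) ≫ c

/-- The pairing `Z ⊗ (L ⊗ A ⊗ R) ⟶ V` induced by a pairing `Z ⊗ A ⟶ V` and actions on `Z`
and `V`. -/
def transposeLeft (d : ExactPairing L R) (b : R ⊗ (Z ⊗ L) ⟶ Z) (c : L ⊗ (V ⊗ R) ⟶ V)
    (g : Z ⊗ A ⟶ V) : Z ⊗ (L ⊗ (A ⊗ R)) ⟶ V :=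
  absorbLeft d.coevaluation' Z A ≫ L ◁ ((b ▷ A ≫ g) ▷ R) ≫ c

/-- Transposing means moving `R` leftwards past `Z` by `exchInvAt`, pairing, and acting on `V`. In
`pairAt_transposeLeft` it is `L` that moves past `Z`, by `exchAt`. -/
theorem pairAt_transposeRight (b : R ⊗ (Z ⊗ L) ⟶ Z) (c : L ⊗ (V ⊗ R) ⟶ V)
    (g : A ⊗ Z ⟶ V) (X : C) :
    pairAt (transposeRight d b c g) X = (α_ L (A ⊗ R) (Z ⊗ X)).hom ≫
      L ◁ (α_ A R (Z ⊗ X)).hom ≫ L ◁ A ◁ exchInvAt d b X ≫ L ◁ pairAt g (R ⊗ X) ≫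
        actAt c X := by
  simp only [pairAt, transposeRight, actAt, exchInvAt, cupAt, absorbRight]
  monoidal

theorem pairAt_transposeLeft (b : R ⊗ (Z ⊗ L) ⟶ Z) (c : L ⊗ (V ⊗ R) ⟶ V)
    (g : Z ⊗ A ⟶ V) (X : C) :
    pairAt (transposeLeft d b c g) X = Z ◁ (α_ L (A ⊗ R) X).hom ≫
      Z ◁ L ◁ (α_ A R X).hom ≫ exchAt d b (A ⊗ (R ⊗ X)) ≫ L ◁ pairAt g (R ⊗ X) ≫
        actAt c X := by
  simp only [pairAt, transposeLeft, actAt, exchAt, cupAt, absorbLeft]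
  monoidal

theorem eq_of_pairAt_unit {g g' : A ⊗ Z ⟶ V} (h : pairAt g (𝟙_ C) = pairAt g' (𝟙_ C)) :
    g = g' := by
  simpa [pairAt] using h

theorem pairAt_whiskerRight_comp {B : C} (f : B ⟶ A) (g : A ⊗ Z ⟶ V) (X : C) :
    pairAt (f ▷ Z ≫ g) X = f ▷ (Z ⊗ X) ≫ pairAt g X := by
  simp [pairAt]

theorem pairAt_whiskerLeft_comp {B : C} (f : B ⟶ A) (g : Z ⊗ A ⟶ V) (X : C) :
    pairAt (Z ◁ f ≫ g) X = Z ◁ f ▷ X ≫ pairAt g X := by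
  simp [pairAt]

section

variable {a : L ⊗ (Z ⊗ R) ⟶ Z} {b : R ⊗ (Z ⊗ L) ⟶ Z} {c : L ⊗ (V ⊗ R) ⟶ V}
  {c' : R ⊗ (V ⊗ L) ⟶ V}

theorem insertRight_whiskerRight (cup : 𝟙_ C ⟶ L ⊗ R) (A X : C) :
    insertRight cup A ▷ X ≫ (α_ L _ X).hom ≫ L ◁ (α_ _ R X).hom ≫ L ◁ (α_ _ _ _).hom ≫
      L ◁ R ◁ (α_ _ _ _).hom = (α_ L _ _).hom ≫ L ◁ (α_ _ _ _).hom ≫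
        L ◁ R ◁ A ◁ cupAt cup X := by
  simp only [insertRight, cupAt]
  monoidal

theorem insertLeft_whiskerRight (cup : 𝟙_ C ⟶ L ⊗ R) (A X : C) :
    insertLeft cup A ▷ X ≫ (α_ L _ X).hom ≫ L ◁ (α_ _ R X).hom ≫ L ◁ (α_ _ _ _).hom ≫
      L ◁ R ◁ (α_ _ _ _).hom = (α_ _ R _).hom ≫ (α_ A L _).hom ≫ cupAt cup _ := by
  simp only [insertLeft, cupAt]
  monoidal

theorem evalLeft_whiskerRight (cap : L ⊗ R ⟶ 𝟙_ C) (A X : C) :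
    evalLeft cap A ▷ X = (α_ L _ _).hom ≫ L ◁ (α_ _ _ _).hom ≫ evalLeft cap (A ⊗ X) := by
  simp only [evalLeft]
  monoidal

theorem evalRight_whiskerRight (cap : L ⊗ R ⟶ 𝟙_ C) (A X : C) :
    evalRight cap A ▷ X = (α_ _ R _).hom ≫ (α_ A L _).hom ≫ A ◁ evalLeft cap X := by
  simp only [evalLeft, evalRight]
  monoidal

theorem pairAt_transposeRight_transposeRight (g : A ⊗ Z ⟶ V) (X : C) :
    pairAt (transposeRight d b c (transposeRight d' a c' g)) X = ((α_ L _ _).hom ≫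
      L ◁ (α_ _ R _).hom ≫ L ◁ (α_ _ _ _).hom ≫ L ◁ R ◁ (α_ _ _ _).hom) ≫
      L ◁ R ◁ A ◁ (L ◁ exchInvAt d b X ≫ exchInvAt d' a (R ⊗ X)) ≫
      L ◁ R ◁ pairAt g (L ⊗ (R ⊗ X)) ≫ L ◁ actAt c' (R ⊗ X) ≫ actAt c X := by
  simp only [pairAt_transposeRight]
  monoidal

theorem pairAt_transposeLeft_transposeLeft (g : Z ⊗ A ⟶ V) (X : C) :
    pairAt (transposeLeft d b c (transposeLeft d' a c' g)) X = Z ◁ ((α_ L _ _).hom ≫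
      L ◁ (α_ _ R _).hom ≫ L ◁ (α_ _ _ _).hom ≫ L ◁ R ◁ (α_ _ _ _).hom) ≫
      exchAt d b (R ⊗ (A ⊗ (L ⊗ (R ⊗ X)))) ≫ L ◁ exchAt d' a (A ⊗ (L ⊗ (R ⊗ X))) ≫
      L ◁ R ◁ pairAt g (L ⊗ (R ⊗ X)) ≫ L ◁ actAt c' (R ⊗ X) ≫ actAt c X := by
  simp only [pairAt_transposeLeft, MonoidalCategory.whiskerLeft_comp, Category.assoc]
  simp only [reassoc_of% exchAt_naturality]

/-- The coevaluation to the right of `A` passes `Z` by two inverse exchanges and then the pairing by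
naturality, where it becomes the left relation of `V`. -/
theorem insertRight_transposeRight (h : Compatible d d' a b) (h' : Compatible d' d b a)
    (hV : Compatible d d' c c') (g : A ⊗ Z ⟶ V) :
    insertRight d.coevaluation' A ▷ Z ≫ transposeRight d b c (transposeRight d' a c' g) =
      evalLeft d'.evaluation' A ▷ Z ≫ g := by
  apply eq_of_pairAt_unit
  rw [pairAt_whiskerRight_comp, pairAt_whiskerRight_comp,
    pairAt_transposeRight_transposeRight, ← Category.assoc (_ ▷ _), insertRight_whiskerRight,
    evalLeft_whiskerRight]
  have e1 := congrArg (fun t => L ◁ R ◁ A ◁ t) (cupAt_exchInvAt h h' (𝟙_ C))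
  have e2 := congrArg (fun t => L ◁ R ◁ t) (pairAt_naturality g (cupAt d.coevaluation' (𝟙_ C)))
  simp only [MonoidalCategory.whiskerLeft_comp] at e1 e2
  simp only [MonoidalCategory.whiskerLeft_comp, Category.assoc]
  rw [reassoc_of% e1, reassoc_of% e2, hV.leftAt, capAt_naturality]

/-- The coevaluation is already leftmost, so the right relation of `V` applies first. The resulting
evaluation is pulled back through the pairing and the two inverse exchanges. -/
theorem insertLeft_transposeRight (h : Compatible d d' a b) (h' : Compatible d' d b a)
    (hV : Compatible d d' c c') (g : A ⊗ Z ⟶ V) :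
    insertLeft d.coevaluation' A ▷ Z ≫ transposeRight d b c (transposeRight d' a c' g) =
      evalRight d'.evaluation' A ▷ Z ≫ g := by
  apply eq_of_pairAt_unit
  rw [pairAt_whiskerRight_comp, pairAt_whiskerRight_comp,
    pairAt_transposeRight_transposeRight, ← Category.assoc (_ ▷ _), insertLeft_whiskerRight,
    evalRight_whiskerRight]
  simp only [Category.assoc]
  rw [← reassoc_of% cupAt_naturality, ← reassoc_of% cupAt_naturality, hV.rightAt, ← pairAt_naturality,
    ← MonoidalCategory.whiskerLeft_comp_assoc A, Category.assoc,
    exchInvAt_exchInvAt_evalLeft h h']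

/-- Transposition on this side uses the exchanges themselves and not their inverses, so one
compatibility on `Z` is enough. -/
theorem insertRight_transposeLeft (h : Compatible d d' a b)
    (hV : Compatible d d' c c') (g : Z ⊗ A ⟶ V) :
    Z ◁ insertRight d.coevaluation' A ≫ transposeLeft d b c (transposeLeft d' a c' g) =
      Z ◁ evalLeft d'.evaluation' A ≫ g := by
  apply eq_of_pairAt_unit
  rw [pairAt_whiskerLeft_comp, pairAt_whiskerLeft_comp,
    pairAt_transposeLeft_transposeLeft, ← MonoidalCategory.whiskerLeft_comp_assoc,
    insertRight_whiskerRight, evalLeft_whiskerRight]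
  simp only [Category.assoc, MonoidalCategory.whiskerLeft_comp]
  have e1 := congrArg (fun t => L ◁ t)
    (exchAt_naturality (d' := d') (a := a) (A ◁ cupAt d.coevaluation' (𝟙_ C)))
  have e2 := congrArg (fun t => L ◁ R ◁ t) (pairAt_naturality g (cupAt d.coevaluation' (𝟙_ C)))
  simp only [MonoidalCategory.whiskerLeft_comp] at e1 e2
  rw [reassoc_of% exchAt_naturality, reassoc_of% e1, reassoc_of% e2, hV.leftAt, capAt_naturality,
    reassoc_of% exchAt_exchAt_evalLeft h]

theorem insertLeft_transposeLeft (h : Compatible d d' a b)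
    (hV : Compatible d d' c c') (g : Z ⊗ A ⟶ V) :
    Z ◁ insertLeft d.coevaluation' A ≫ transposeLeft d b c (transposeLeft d' a c' g) =
      Z ◁ evalRight d'.evaluation' A ≫ g := by
  apply eq_of_pairAt_unit
  rw [pairAt_whiskerLeft_comp, pairAt_whiskerLeft_comp,
    pairAt_transposeLeft_transposeLeft, ← MonoidalCategory.whiskerLeft_comp_assoc,
    insertLeft_whiskerRight, evalRight_whiskerRight]
  simp only [Category.assoc, MonoidalCategory.whiskerLeft_comp]
  rw [reassoc_of% whiskerLeft_cupAt_exchAt h, ← reassoc_of% cupAt_naturality, hV.rightAt, pairAt_naturality]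

/-- Splitting and acting on `Z` exchanges `Z` with `R`, and transposition exchanges back. This is
what makes the inverse fusion morphism commute with the actions. -/
theorem split_transposeRight (h' : Compatible d' d b a) (g : A ⊗ Z ⟶ V) :
    split d'.coevaluation' A Z ≫ (L ⊗ (A ⊗ R)) ◁ a ≫ transposeRight d b c g =
      L ◁ (g ▷ R) ≫ c := by
  apply eq_of_whiskerRight_unit
  calc _ = 𝟙 _ ⊗≫ L ◁ A ◁ (exchAt d' a (𝟙_ C) ≫ exchInvAt d b (𝟙_ C)) ⊗≫
        L ◁ pairAt g (R ⊗ 𝟙_ C) ≫ actAt c (𝟙_ C) ⊗≫ 𝟙 _ := by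
        simp only [pairAt, transposeRight, actAt, exchInvAt, exchAt, cupAt, absorbRight, split]
        monoidal
    _ = _ := by
        rw [exchAt_exchInvAt h']
        simp only [pairAt, actAt]
        monoidal

theorem split_transposeLeft (h : Compatible d' d b a) (g : Z ⊗ A ⟶ V) :
    split d'.coevaluation' Z A ≫ a ▷ (L ⊗ (A ⊗ R)) ≫ transposeLeft d b c g =
      L ◁ (g ▷ R) ≫ c := by
  apply eq_of_whiskerRight_unit
  calc _ = 𝟙 _ ⊗≫ (exchInvAt d' a (A ⊗ (R ⊗ 𝟙_ C)) ≫ exchAt d b (A ⊗ (R ⊗ 𝟙_ C))) ⊗≫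
        L ◁ pairAt g (R ⊗ 𝟙_ C) ≫ actAt c (𝟙_ C) ⊗≫ 𝟙 _ := by
        simp only [pairAt, transposeLeft, actAt, exchInvAt, exchAt, cupAt, absorbLeft, split]
        monoidal
    _ = _ := by
        rw [exchInvAt_exchAt h]
        simp only [pairAt, actAt]
        monoidal

/-- The tensor action on `B ⊗ Z` exchanges `Z` with `R` again, undoing the inverse exchange of the
transposition. This is the inductive step for inverse fusion followed by fusion. -/
theorem transposeRight_tensorAct (h : Compatible d d' a b) {B : C} (e : L ⊗ (B ⊗ R) ⟶ B)
    (f : A ⟶ B) :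
    transposeRight d b (tensorAct d' e a) (f ▷ Z) = (L ◁ (f ▷ R) ≫ e) ▷ Z := by
  apply eq_of_whiskerRight_unit
  calc _ = 𝟙 _ ⊗≫ L ◁ A ◁ exchInvAt d b (𝟙_ C) ≫ L ◁ (f ▷ (Z ⊗ (R ⊗ 𝟙_ C)) ≫
        B ◁ exchAt d' a (𝟙_ C)) ⊗≫ actAt e (Z ⊗ 𝟙_ C) ⊗≫ 𝟙 _ := by
        simp only [transposeRight, actAt, exchInvAt, exchAt, cupAt, absorbRight, split, tensorAct,
          tensorHom_def']
        monoidal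
    _ = 𝟙 _ ⊗≫ L ◁ A ◁ (exchInvAt d b (𝟙_ C) ≫ exchAt d' a (𝟙_ C)) ≫
        L ◁ f ▷ (R ⊗ (Z ⊗ 𝟙_ C)) ⊗≫ actAt e (Z ⊗ 𝟙_ C) ⊗≫ 𝟙 _ := by
        rw [← whisker_exchange]
        monoidal
    _ = _ := by
        rw [exchInvAt_exchAt h]
        simp only [actAt]
        monoidal

theorem transposeLeft_tensorAct (h : Compatible d d' a b) {B : C} (e : L ⊗ (B ⊗ R) ⟶ B)
    (f : A ⟶ B) :
    transposeLeft d b (tensorAct d' a e) (Z ◁ f) = Z ◁ (L ◁ (f ▷ R) ≫ e) := by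
  apply eq_of_whiskerRight_unit
  calc _ = 𝟙 _ ⊗≫ exchAt d b (A ⊗ (R ⊗ 𝟙_ C)) ≫ L ◁ Z ◁ f ▷ (R ⊗ 𝟙_ C) ≫
        exchInvAt d' a (B ⊗ (R ⊗ 𝟙_ C)) ≫ Z ◁ actAt e (𝟙_ C) ⊗≫ 𝟙 _ := by
        simp only [transposeLeft, actAt, exchInvAt, exchAt, cupAt, absorbLeft, split, tensorAct,
          MonoidalCategory.tensorHom_def]
        monoidal
    _ = _ := by
        rw [reassoc_of% exchInvAt_naturality, reassoc_of% exchAt_exchInvAt h]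
        simp only [actAt]
        monoidal

end

end Sandwich

/-! ### Naturality of the insertions and coherence of tensor actions -/

namespace Sandwich

variable {C : Type u} [Category.{v} C] [MonoidalCategory C] {L R Z W V A B : C}

theorem split_naturality (cup : 𝟙_ C ⟶ R ⊗ L) {A A' B B' : C} (f : A ⟶ A') (g : B ⟶ B') :
    L ◁ ((f ⊗ₘ g) ▷ R) ≫ split cup A' B' =
      split cup A B ≫ (L ◁ (f ▷ R) ⊗ₘ L ◁ (g ▷ R)) := by
  apply eq_of_whiskerRight_unit
  calc _ = 𝟙 _ ⊗≫ L ◁ f ▷ (B ⊗ R) ⊗≫ L ◁ A' ◁ (g ▷ R ≫ cupAt cup (B' ⊗ R)) ⊗≫ 𝟙 _ := by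
        simp only [split, cupAt, MonoidalCategory.tensorHom_def]
        monoidal
    _ = 𝟙 _ ⊗≫ L ◁ (f ▷ (B ⊗ R) ≫ A' ◁ cupAt cup (B ⊗ R)) ⊗≫
        L ◁ A' ◁ R ◁ L ◁ (g ▷ R) ⊗≫ 𝟙 _ := by
        rw [cupAt_naturality]
        monoidal
    _ = _ := by
        rw [← whisker_exchange]
        simp only [split, cupAt, MonoidalCategory.tensorHom_def]
        monoidal

theorem absorbRight_naturality (cup : 𝟙_ C ⟶ L ⊗ R) (A : C) {B B' : C} (f : B ⟶ B') :
    (L ⊗ (A ⊗ R)) ◁ f ≫ absorbRight cup A B' =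
      absorbRight cup A B ≫ L ◁ ((A ◁ (R ◁ (f ▷ L))) ▷ R) := by
  have h : f ≫ (ρ_ B').inv ≫ B' ◁ cup = ((ρ_ B).inv ≫ B ◁ cup) ≫ f ▷ (L ⊗ R) := by
    rw [Category.assoc, whisker_exchange, rightUnitor_inv_naturality_assoc]
  simp only [absorbRight, monoidalComp, Category.comp_id]
  rw [← MonoidalCategory.whiskerLeft_comp_assoc, h]
  monoidal

theorem absorbLeft_naturality (cup : 𝟙_ C ⟶ L ⊗ R) {A A' : C} (f : A ⟶ A') (B : C) :
    f ▷ (L ⊗ (B ⊗ R)) ≫ absorbLeft cup A' B =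
      absorbLeft cup A B ≫ L ◁ (((R ◁ (f ▷ L)) ▷ B) ▷ R) := by
  have h : f ≫ (λ_ A').inv ≫ cup ▷ A' = ((λ_ A).inv ≫ cup ▷ A) ≫ (L ⊗ R) ◁ f := by
    rw [Category.assoc, ← whisker_exchange, leftUnitor_inv_naturality_assoc]
  simp only [absorbLeft, monoidalComp, Category.comp_id]
  rw [← comp_whiskerRight_assoc, h]
  monoidal

theorem absorbRight_naturality_left (cup : 𝟙_ C ⟶ L ⊗ R) {A A' : C} (f : A ⟶ A') (B : C) :
    (L ◁ (f ▷ R)) ▷ B ≫ absorbRight cup A' B =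
      absorbRight cup A B ≫ L ◁ ((f ▷ (R ⊗ (B ⊗ L))) ▷ R) := by
  simp only [absorbRight, monoidalComp, Category.comp_id]
  rw [← whisker_exchange_assoc]
  monoidal

theorem absorbLeft_naturality_right (cup : 𝟙_ C ⟶ L ⊗ R) (A : C) {B B' : C} (f : B ⟶ B') :
    A ◁ (L ◁ (f ▷ R)) ≫ absorbLeft cup A B' =
      absorbLeft cup A B ≫ L ◁ (((R ⊗ (A ⊗ L)) ◁ f) ▷ R) := by
  simp only [absorbLeft, monoidalComp, Category.comp_id]
  rw [whisker_exchange_assoc]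
  monoidal

variable {d : ExactPairing L R} {d' : ExactPairing R L}

/-- The hexagon identity: passing `Z ⊗ W` means passing `W` and then `Z`. Compatibility with the
associator follows from it. -/
theorem exchAt_tensorAct (a : L ⊗ (Z ⊗ R) ⟶ Z) (a' : L ⊗ (W ⊗ R) ⟶ W) (X : C) :
    exchAt d' (tensorAct d' a a') X = (α_ Z W (R ⊗ X)).hom ≫ Z ◁ exchAt d' a' X ≫
      exchAt d' a (W ⊗ X) ≫ R ◁ (α_ Z W X).inv := by
  conv_lhs => rw [exchAt, actAt_tensorAct]
  simp only [MonoidalCategory.whiskerLeft_comp]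
  rw [← reassoc_of% cupAt_naturality, ← reassoc_of% cupAt_naturality, exchAt, exchAt]
  simp

theorem tensorAct_associator (a : L ⊗ (Z ⊗ R) ⟶ Z) (a' : L ⊗ (W ⊗ R) ⟶ W)
    (a'' : L ⊗ (V ⊗ R) ⟶ V) :
    tensorAct d' (tensorAct d' a a') a'' ≫ (α_ Z W V).hom =
      L ◁ ((α_ Z W V).hom ▷ R) ≫ tensorAct d' a (tensorAct d' a' a'') := by
  apply eq_of_whiskerRight_unit
  calc _ = 𝟙 _ ⊗≫ actAt (tensorAct d' (tensorAct d' a a') a'') (𝟙_ C) ⊗≫ 𝟙 _ := by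
        simp only [actAt]; monoidal
    _ = 𝟙 _ ⊗≫ actAt (tensorAct d' a (tensorAct d' a' a'')) (𝟙_ C) ⊗≫ 𝟙 _ := by
        simp only [actAt_tensorAct, exchAt_tensorAct]
        simp only [actAt]
        monoidal
    _ = _ := by
        simp only [actAt]; monoidal

theorem tensorAct_leftUnitor (a : L ⊗ (Z ⊗ R) ⟶ Z) :
    tensorAct d' (unitAct d') a ≫ (λ_ Z).hom = L ◁ ((λ_ Z).hom ▷ R) ≫ a := by
  apply eq_of_whiskerRight_unit
  calc _ = 𝟙 _ ⊗≫ actAt (tensorAct d' (unitAct d') a) (𝟙_ C) ⊗≫ 𝟙 _ := by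
        simp only [actAt]; monoidal
    _ = 𝟙 _ ⊗≫ (L ◁ exchAt d' a (𝟙_ C) ≫ evalLeft d'.evaluation' (Z ⊗ 𝟙_ C)) ⊗≫ 𝟙 _ := by
        simp only [actAt_tensorAct, actAt_unitAct]
        monoidal
    _ = _ := by
        rw [whiskerLeft_exchAt_evalLeft]
        simp only [actAt]; monoidal

theorem exchAt_unitAct (X : C) :
    exchAt d' (unitAct d') X = (λ_ (R ⊗ X)).hom ≫ R ◁ (λ_ X).inv := by
  rw [exchAt, actAt_unitAct, MonoidalCategory.whiskerLeft_comp, ← reassoc_of% cupAt_naturality,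
    MonoidalCategory.whiskerLeft_comp, reassoc_of% cupAt_evalLeft]

theorem tensorAct_rightUnitor (a : L ⊗ (Z ⊗ R) ⟶ Z) :
    tensorAct d' a (unitAct d') ≫ (ρ_ Z).hom = L ◁ ((ρ_ Z).hom ▷ R) ≫ a := by
  apply eq_of_whiskerRight_unit
  calc _ = 𝟙 _ ⊗≫ actAt (tensorAct d' a (unitAct d')) (𝟙_ C) ⊗≫ 𝟙 _ := by
        simp only [actAt]; monoidal
    _ = _ := by
        simp only [actAt_tensorAct, exchAt_unitAct]
        simp only [actAt]
        monoidal

/-! ### Actions and half braidings -/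

/-- An action is an exchange followed by an evaluation, so each relation reduces to the cancellation
of an exchange with its inverse. -/
theorem Compatible.of_exchAt {a : L ⊗ (Z ⊗ R) ⟶ Z} {b : R ⊗ (Z ⊗ L) ⟶ Z}
    (h : ∀ X, exchInvAt d b X ≫ exchAt d' a X = 𝟙 _)
    (h' : ∀ X, exchAt d b X ≫ exchInvAt d' a X = 𝟙 _) : Compatible d d' a b := by
  apply Compatible.of_at
  · rw [← whiskerLeft_exchAt_evalLeft (d' := d'), ← MonoidalCategory.whiskerLeft_comp_assoc,
      ← MonoidalCategory.whiskerLeft_comp_assoc, ← exchInvAt, h, MonoidalCategory.whiskerLeft_id,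
      Category.id_comp]
  · rw [← exchInvAt_whiskerLeft_evalLeft (d := d'), ← Category.assoc, ← exchAt,
      reassoc_of% h']

/-- The action `L ⊗ Z ⊗ R ⟶ Z` induced by `σ : Z ⊗ R ⟶ R ⊗ Z`. -/
def actOfBraid (d' : ExactPairing R L) (σ : Z ⊗ R ⟶ R ⊗ Z) : L ⊗ (Z ⊗ R) ⟶ Z :=
  L ◁ σ ≫ evalLeft d'.evaluation' Z

/-- The action `R ⊗ Z ⊗ L ⟶ Z` induced by `τ : R ⊗ Z ⟶ Z ⊗ R`. -/
def actOfBraidInv (d : ExactPairing L R) (τ : R ⊗ Z ⟶ Z ⊗ R) : R ⊗ (Z ⊗ L) ⟶ Z :=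
  (α_ R Z L).inv ≫ τ ▷ L ≫ evalRight d.evaluation' Z

/-- The half braiding `Z ⊗ R ⟶ R ⊗ Z` induced by an action `L ⊗ Z ⊗ R ⟶ Z`. -/
def braidOfAct (d' : ExactPairing R L) (a : L ⊗ (Z ⊗ R) ⟶ Z) : Z ⊗ R ⟶ R ⊗ Z :=
  Z ◁ (ρ_ R).inv ≫ exchAt d' a (𝟙_ C) ≫ R ◁ (ρ_ Z).hom

/-- The morphism `R ⊗ Z ⟶ Z ⊗ R` induced by an action `R ⊗ Z ⊗ L ⟶ Z`. -/
def braidInvOfAct (d : ExactPairing L R) (b : R ⊗ (Z ⊗ L) ⟶ Z) : R ⊗ Z ⟶ Z ⊗ R :=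
  R ◁ (ρ_ Z).inv ≫ exchInvAt d b (𝟙_ C) ≫ Z ◁ (ρ_ R).hom

/-- A zigzag cancels the coevaluation of the exchange against the evaluation in `actOfBraid`,
leaving `σ`. -/
theorem exchAt_actOfBraid (σ : Z ⊗ R ⟶ R ⊗ Z) (X : C) :
    exchAt d' (actOfBraid d' σ) X = (α_ Z R X).inv ≫ σ ▷ X ≫ (α_ R Z X).hom := by
  have h : actAt (actOfBraid d' σ) X = L ◁ ((α_ Z R X).inv ≫ σ ▷ X ≫ (α_ R Z X).hom) ≫
      evalLeft d'.evaluation' (Z ⊗ X) := by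
    simp only [actAt, actOfBraid, evalLeft]; monoidal
  rw [exchAt, h, MonoidalCategory.whiskerLeft_comp, ← reassoc_of% cupAt_naturality, cupAt_evalLeft,
    Category.comp_id]

theorem exchInvAt_actOfBraidInv (τ : R ⊗ Z ⟶ Z ⊗ R) (X : C) :
    exchInvAt d (actOfBraidInv d τ) X = (α_ R Z X).inv ≫ τ ▷ X ≫ (α_ Z R X).hom := by
  have h : actAt (actOfBraidInv d τ) (R ⊗ X) = (α_ R Z _).inv ≫ τ ▷ (L ⊗ (R ⊗ X)) ≫
      (α_ Z R _).hom ≫ Z ◁ evalLeft d.evaluation' (R ⊗ X) := by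
    simp only [actAt, actOfBraidInv, evalLeft, evalRight]; monoidal
  rw [exchInvAt, h, associator_inv_naturality_right_assoc, whisker_exchange_assoc,
    associator_naturality_right_assoc, ← MonoidalCategory.whiskerLeft_comp,
    whiskerLeft_cupAt_evalLeft, MonoidalCategory.whiskerLeft_id, Category.comp_id]

theorem actOfBraid_braidOfAct (a : L ⊗ (Z ⊗ R) ⟶ Z) :
    actOfBraid d' (braidOfAct d' a) = a := by
  apply eq_of_whiskerRight_unit
  calc _ = 𝟙 _ ⊗≫ (L ◁ exchAt d' a (𝟙_ C) ≫ evalLeft d'.evaluation' (Z ⊗ 𝟙_ C)) ⊗≫ 𝟙 _ := by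
        simp only [actOfBraid, braidOfAct, evalLeft]; monoidal
    _ = _ := by
        rw [whiskerLeft_exchAt_evalLeft]
        simp only [actAt]; monoidal

theorem actOfBraidInv_braidInvOfAct (b : R ⊗ (Z ⊗ L) ⟶ Z) :
    actOfBraidInv d (braidInvOfAct d b) = b := by
  apply eq_of_whiskerRight_unit
  calc _ = 𝟙 _ ⊗≫ (exchInvAt d b (L ⊗ 𝟙_ C) ≫ Z ◁ evalLeft d.evaluation' (𝟙_ C)) ⊗≫ 𝟙 _ := by
        simp only [actOfBraidInv, braidInvOfAct, evalLeft, evalRight, exchInvAt, actAt, cupAt]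
        monoidal
    _ = _ := by
        rw [exchInvAt_whiskerLeft_evalLeft]
        simp only [actAt]; monoidal

theorem braidOfAct_actOfBraid (σ : Z ⊗ R ⟶ R ⊗ Z) :
    braidOfAct d' (actOfBraid d' σ) = σ := by
  rw [braidOfAct, exchAt_actOfBraid]
  monoidal

theorem braidOfAct_comp {a : L ⊗ (Z ⊗ R) ⟶ Z} {b : R ⊗ (Z ⊗ L) ⟶ Z}
    (h : Compatible d' d b a) : braidOfAct d' a ≫ braidInvOfAct d b = 𝟙 _ := by
  simp only [braidOfAct, braidInvOfAct, Category.assoc,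
    ← MonoidalCategory.whiskerLeft_comp_assoc R, Iso.hom_inv_id, MonoidalCategory.whiskerLeft_id,
    Category.id_comp, reassoc_of% exchAt_exchInvAt h]
  simp

theorem braidInvOfAct_comp {a : L ⊗ (Z ⊗ R) ⟶ Z} {b : R ⊗ (Z ⊗ L) ⟶ Z}
    (h : Compatible d d' a b) : braidInvOfAct d b ≫ braidOfAct d' a = 𝟙 _ := by
  simp only [braidOfAct, braidInvOfAct, Category.assoc,
    ← MonoidalCategory.whiskerLeft_comp_assoc Z, Iso.hom_inv_id, MonoidalCategory.whiskerLeft_id,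
    Category.id_comp, reassoc_of% exchInvAt_exchAt h]
  simp

/-- A morphism commutes with actions if it commutes with the half braidings. -/
theorem actOfBraid_naturality {σ : Z ⊗ R ⟶ R ⊗ Z} {τ : W ⊗ R ⟶ R ⊗ W} {f : Z ⟶ W}
    (h : f ▷ R ≫ τ = σ ≫ R ◁ f) :
    L ◁ (f ▷ R) ≫ actOfBraid d' τ = actOfBraid d' σ ≫ f := by
  rw [actOfBraid, ← MonoidalCategory.whiskerLeft_comp_assoc, h,
    MonoidalCategory.whiskerLeft_comp_assoc, evalLeft_naturality, actOfBraid, Category.assoc]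

theorem actOfBraidInv_naturality {σ : R ⊗ Z ⟶ Z ⊗ R} {τ : R ⊗ W ⟶ W ⊗ R} {f : Z ⟶ W}
    (h : R ◁ f ≫ τ = σ ≫ f ▷ R) :
    R ◁ (f ▷ L) ≫ actOfBraidInv d τ = actOfBraidInv d σ ≫ f := by
  rw [actOfBraidInv, associator_inv_naturality_middle_assoc, ← comp_whiskerRight_assoc, h,
    comp_whiskerRight_assoc, evalRight_naturality, actOfBraidInv, Category.assoc, Category.assoc]

theorem braidOfAct_naturality {a : L ⊗ (Z ⊗ R) ⟶ Z} {a' : L ⊗ (W ⊗ R) ⟶ W} {f : Z ⟶ W}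
    (h : L ◁ (f ▷ R) ≫ a' = a ≫ f) :
    f ▷ R ≫ braidOfAct d' a' = braidOfAct d' a ≫ R ◁ f := by
  have e : L ◁ (f ▷ (R ⊗ 𝟙_ C)) ≫ actAt a' (𝟙_ C) = actAt a (𝟙_ C) ≫ f ▷ 𝟙_ C := by
    calc _ = 𝟙 _ ⊗≫ (L ◁ (f ▷ R) ≫ a') ▷ 𝟙_ C ⊗≫ 𝟙 _ := by simp only [actAt]; monoidal
      _ = _ := by rw [h]; simp only [actAt]; monoidal
  rw [braidOfAct, exchAt, ← whisker_exchange_assoc, Category.assoc, reassoc_of% cupAt_naturality,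
    ← MonoidalCategory.whiskerLeft_comp_assoc R, e, braidOfAct, exchAt]
  simp

end Sandwich

/-! ### Objects with actions of the two functors -/

namespace PivotalPair

open PivSign Sandwich

variable {C : Type u} [Category.{v} C] [MonoidalCategory C] (p : PivotalPair C)

/-- An object with actions of `F₊` and `F₋` which coequalize the four parallel pairs. -/
structure SignAction where
  obj : C
  act : ∀ i : PivSign, (p.F i).obj obj ⟶ obj
  rel : ∀ k : PivKind, p.insertApp k obj ≫ (p.F k.sign).map (act k.sign.neg) ≫ act k.sign =
    p.evalApp k obj

namespace SignAction

variable {p}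

theorem compatible_plus (M : p.SignAction) :
    Compatible (L := p.Q) (R := p.P) p.rightDual p.leftDual (M.act plus) (M.act minus) where
  left := M.rel .leftQP
  right := M.rel .rightQP

theorem compatible_minus (M : p.SignAction) :
    Compatible (L := p.P) (R := p.Q) p.leftDual p.rightDual (M.act minus) (M.act plus) where
  left := M.rel .leftPQ
  right := M.rel .rightPQ

theorem rel_of_compatible {Z : C} {act : ∀ i : PivSign, (p.F i).obj Z ⟶ Z}
    (h : Compatible (L := p.Q) (R := p.P) p.rightDual p.leftDual (act plus) (act minus))
    (h' : Compatible (L := p.P) (R := p.Q) p.leftDual p.rightDual (act minus) (act plus)) :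
    ∀ k : PivKind, p.insertApp k Z ≫ (p.F k.sign).map (act k.sign.neg) ≫ act k.sign =
      p.evalApp k Z
  | .leftPQ => h'.left
  | .rightPQ => h'.right
  | .leftQP => h.left
  | .rightQP => h.right

/-- Morphisms commuting with the actions. -/
def IsHom (M N : p.SignAction) (f : M.obj ⟶ N.obj) : Prop :=
  ∀ i : PivSign, (p.F i).map f ≫ N.act i = M.act i ≫ f

theorem IsHom.comp {M N K : p.SignAction} {f : M.obj ⟶ N.obj} {g : N.obj ⟶ K.obj}
    (hf : M.IsHom N f) (hg : N.IsHom K g) : M.IsHom K (f ≫ g) := fun i => by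
  rw [Functor.map_comp, Category.assoc, hg i, ← Category.assoc, hf i, Category.assoc]

theorem IsHom.id (M : p.SignAction) : M.IsHom M (𝟙 M.obj) := fun i => by simp

/-- The tensor product of two actions. -/
abbrev tensor (M N : p.SignAction) : p.SignAction where
  obj := M.obj ⊗ N.obj
  act i := p.splitSign i M.obj N.obj ≫ (M.act i ⊗ₘ N.act i)
  rel := rel_of_compatible (act := fun i => p.splitSign i M.obj N.obj ≫ (M.act i ⊗ₘ N.act i))
    (M.compatible_plus.tensor N.compatible_plus)
    (M.compatible_minus.tensor N.compatible_minus)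

variable (p) in
/-- The action on the unit object. -/
abbrev unit : p.SignAction where
  obj := 𝟙_ C
  act := p.evSign
  rel := rel_of_compatible Compatible.unit Compatible.unit

theorem splitSign_naturality (i : PivSign) {A A' B B' : C} (f : A ⟶ A') (g : B ⟶ B') :
    (p.F i).map (f ⊗ₘ g) ≫ p.splitSign i A' B' =
      p.splitSign i A B ≫ ((p.F i).map f ⊗ₘ (p.F i).map g) := by
  cases i
  · exact split_naturality p.coevL f g
  · exact split_naturality p.coevR f g

theorem IsHom.tensor {M N M' N' : p.SignAction} {f : M.obj ⟶ M'.obj} {g : N.obj ⟶ N'.obj}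
    (hf : M.IsHom M' f) (hg : N.IsHom N' g) :
    (M.tensor N).IsHom (M'.tensor N') (f ⊗ₘ g) := fun i => by
  change (p.F i).map (f ⊗ₘ g) ≫ p.splitSign i _ _ ≫ (M'.act i ⊗ₘ N'.act i) =
    (p.splitSign i _ _ ≫ (M.act i ⊗ₘ N.act i)) ≫ (f ⊗ₘ g)
  rw [reassoc_of% splitSign_naturality i f g, Category.assoc,
    MonoidalCategory.tensorHom_comp_tensorHom, MonoidalCategory.tensorHom_comp_tensorHom,
    hf i, hg i]

theorem isHom_associator (M N K : p.SignAction) :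
    ((M.tensor N).tensor K).IsHom (M.tensor (N.tensor K)) (α_ M.obj N.obj K.obj).hom
  | plus => (tensorAct_associator (d' := p.leftDual) (M.act plus) (N.act plus) (K.act plus)).symm
  | minus =>
    (tensorAct_associator (d' := p.rightDual) (M.act minus) (N.act minus) (K.act minus)).symm

theorem isHom_leftUnitor (M : p.SignAction) :
    ((unit p).tensor M).IsHom M (λ_ M.obj).hom
  | plus => (tensorAct_leftUnitor (d' := p.leftDual) (M.act plus)).symm
  | minus => (tensorAct_leftUnitor (d' := p.rightDual) (M.act minus)).symm

theorem isHom_rightUnitor (M : p.SignAction) :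
    (M.tensor (unit p)).IsHom M (ρ_ M.obj).hom
  | plus => (tensorAct_rightUnitor (d' := p.leftDual) (M.act plus)).symm
  | minus => (tensorAct_rightUnitor (d' := p.rightDual) (M.act minus)).symm

/-- The iterated action. -/
def iter (M : p.SignAction) : ∀ w : List PivSign, (p.word w).obj M.obj ⟶ M.obj
  | [] => 𝟙 M.obj
  | i :: w => (p.F i).map (iter M w) ≫ M.act i

end SignAction

/-! ### Extending morphisms along words -/

/-- A rule which extends morphisms `G(A) ⟶ V` to morphisms `G(F_± A) ⟶ V`, compatibly with the
four parallel pairs. -/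
structure ExtensionRule (G : C ⥤ C) (V : C) where
  next : ∀ (i : PivSign) (A : C), (G.obj A ⟶ V) → (G.obj ((p.F i).obj A) ⟶ V)
  next_comp : ∀ (i : PivSign) {A B : C} (f : A ⟶ B) (g : G.obj B ⟶ V),
    next i A (G.map f ≫ g) = G.map ((p.F i).map f) ≫ next i B g
  rel : ∀ (k : PivKind) (A : C) (g : G.obj A ⟶ V),
    G.map (p.insertApp k A) ≫ next k.sign _ (next k.sign.neg A g) = G.map (p.evalApp k A) ≫ g

namespace ExtensionRule

variable {p} {G : C ⥤ C} {V : C} (E : p.ExtensionRule G V)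

/-- The extension of `g : G(X) ⟶ V` to `G(F_w X) ⟶ V`. -/
def iter {X : C} (g : G.obj X ⟶ V) : ∀ w : List PivSign, G.obj ((p.word w).obj X) ⟶ V
  | [] => g
  | i :: w => E.next i ((p.word w).obj X) (iter g w)

theorem iter_comp {X Y : C} (f : X ⟶ Y) (g : G.obj Y ⟶ V) :
    ∀ w : List PivSign, E.iter (G.map f ≫ g) w = G.map ((p.word w).map f) ≫ E.iter g w
  | [] => rfl
  | i :: w => by
    change E.next i _ (E.iter _ w) = G.map ((p.F i).map ((p.word w).map f)) ≫ E.next i _ (E.iter g w)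
    rw [iter_comp f g w, E.next_comp]

theorem append_iter {X : C} (g : G.obj X ⟶ V) (w : List PivSign) : ∀ u : List PivSign,
    G.map ((p.append u w).app X) ≫ E.iter g (u ++ w) = E.iter (E.iter g w) u
  | [] => by
    change G.map (𝟙 _) ≫ E.iter g w = E.iter g w
    simp
  | i :: u => by
    have h : (p.append (i :: u) w).app X = (p.F i).map ((p.append u w).app X) :=
      Category.id_comp _
    change _ ≫ E.next i _ (E.iter g (u ++ w)) = E.next i _ (E.iter (E.iter g w) u)
    rw [h, ← append_iter g w u, E.next_comp]
    rfl

theorem map_append_iter {X : C} (g : G.obj X ⟶ V) (u w : List PivSign) {A : C}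
    (f : A ⟶ (p.word w).obj X) :
    G.map ((p.word u).map f ≫ (p.append u w).app X) ≫ E.iter g (u ++ w) =
      E.iter (G.map f ≫ E.iter g w) u := by
  rw [iter_comp, ← append_iter]
  exact (congrArg (· ≫ _) (G.map_comp _ _)).trans (Category.assoc _ _ _)

/-- Extension along `u ++ w` is extension along `u` of the extension along `w`, so only the rule's
relation with empty outer word is needed. -/
theorem fst_iter {X : C} (g : G.obj X ⟶ V) (r : PivRel) :
    G.map ((p.index.fst r).app X) ≫ E.iter g (pivShape.fst r) =
      G.map ((p.index.snd r).app X) ≫ E.iter g (pivShape.snd r) := by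
  obtain ⟨k, u, w⟩ := r
  exact (E.map_append_iter g u (k.sign :: k.sign.neg :: w) (p.insertApp k _)).trans
    ((congrArg (fun t => E.iter t u) (E.rel k _ (E.iter g w))).trans
      (E.map_append_iter g u w (p.evalApp k _)).symm)

end ExtensionRule

/-- Actions on `V` extend morphisms `A ⟶ V`. -/
def SignAction.rule {p : PivotalPair C} (V : p.SignAction) : p.ExtensionRule (𝟭 C) V.obj where
  next i _ g := (p.F i).map g ≫ V.act i
  next_comp i _ _ f g := by
    change (p.F i).map (f ≫ g) ≫ _ = (p.F i).map f ≫ (p.F i).map g ≫ _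
    rw [Functor.map_comp, Category.assoc]
  rel k A g := by
    change p.insertApp k A ≫ (p.F k.sign).map ((p.F k.sign.neg).map g ≫ V.act k.sign.neg) ≫
      V.act k.sign = p.evalApp k A ≫ g
    rw [Functor.map_comp, Category.assoc, ← p.evalApp_naturality, ← V.rel,
      ← reassoc_of% p.insertApp_naturality k g]

theorem absorbRightSign_naturality_left (i : PivSign) {A A' : C} (f : A ⟶ A') (B : C) :
    (p.F i).map f ▷ B ≫ p.absorbRightSign i A' B =
      p.absorbRightSign i A B ≫ (p.F i).map (f ▷ (p.F i.neg).obj B) := by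
  cases i
  · exact absorbRight_naturality_left p.coevR f B
  · exact absorbRight_naturality_left p.coevL f B

theorem absorbRightSign_naturality (i : PivSign) (A : C) {B B' : C} (f : B ⟶ B') :
    (p.F i).obj A ◁ f ≫ p.absorbRightSign i A B' =
      p.absorbRightSign i A B ≫ (p.F i).map (A ◁ (p.F i.neg).map f) := by
  cases i
  · exact absorbRight_naturality p.coevR A f
  · exact absorbRight_naturality p.coevL A f

theorem absorbLeftSign_naturality_right (i : PivSign) (A : C) {B B' : C} (f : B ⟶ B') :
    A ◁ (p.F i).map f ≫ p.absorbLeftSign i A B' =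
      p.absorbLeftSign i A B ≫ (p.F i).map ((p.F i.neg).obj A ◁ f) := by
  cases i
  · exact absorbLeft_naturality_right p.coevR A f
  · exact absorbLeft_naturality_right p.coevL A f

theorem absorbLeftSign_naturality (i : PivSign) {A A' : C} (f : A ⟶ A') (B : C) :
    f ▷ (p.F i).obj B ≫ p.absorbLeftSign i A' B =
      p.absorbLeftSign i A B ≫ (p.F i).map ((p.F i.neg).map f ▷ B) := by
  cases i
  · exact absorbLeft_naturality p.coevR f B
  · exact absorbLeft_naturality p.coevL f B

/-- Actions on `Z` and `V` extend morphisms `A ⊗ Z ⟶ V`. -/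
def SignAction.ruleRight {p : PivotalPair C} (Z V : p.SignAction) :
    p.ExtensionRule (tensorRight Z.obj) V.obj where
  next i A g := p.absorbRightSign i A Z.obj ≫ (p.F i).map (A ◁ Z.act i.neg ≫ g) ≫ V.act i
  next_comp i A B f g := by
    change _ ≫ (p.F i).map (A ◁ Z.act i.neg ≫ f ▷ Z.obj ≫ g) ≫ _ = (p.F i).map f ▷ Z.obj ≫ _
    rw [whisker_exchange_assoc, Functor.map_comp, Category.assoc,
      reassoc_of% absorbRightSign_naturality_left p i f]
  rel k A g := by
    cases k
    · exact insertRight_transposeRight Z.compatible_minus Z.compatible_plus V.compatible_minus g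
    · exact insertLeft_transposeRight Z.compatible_minus Z.compatible_plus V.compatible_minus g
    · exact insertRight_transposeRight Z.compatible_plus Z.compatible_minus V.compatible_plus g
    · exact insertLeft_transposeRight Z.compatible_plus Z.compatible_minus V.compatible_plus g

/-- Actions on `Z` and `V` extend morphisms `Z ⊗ A ⟶ V`. -/
def SignAction.ruleLeft {p : PivotalPair C} (Z V : p.SignAction) :
    p.ExtensionRule (tensorLeft Z.obj) V.obj where
  next i A g := p.absorbLeftSign i Z.obj A ≫ (p.F i).map (Z.act i.neg ▷ A ≫ g) ≫ V.act i
  next_comp i A B f g := by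
    change _ ≫ (p.F i).map (Z.act i.neg ▷ A ≫ Z.obj ◁ f ≫ g) ≫ _ = Z.obj ◁ (p.F i).map f ≫ _
    rw [← whisker_exchange_assoc, Functor.map_comp, Category.assoc,
      reassoc_of% absorbLeftSign_naturality_right p i Z.obj f]
  rel k A g := by
    cases k
    · exact insertRight_transposeLeft Z.compatible_minus V.compatible_minus g
    · exact insertLeft_transposeLeft Z.compatible_minus V.compatible_minus g
    · exact insertRight_transposeLeft Z.compatible_plus V.compatible_plus g
    · exact insertLeft_transposeLeft Z.compatible_plus V.compatible_plus g

end PivotalPair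

/-! ### The universal property of `T(X)` as a free action -/

namespace PivotalPair

open PivSign Sandwich

variable {C : Type u} [Category.{v} C] [MonoidalCategory C] (p : PivotalPair C)

section Colimit

variable [∀ X : C, HasColimit (p.index.multispan.flip.obj X)]

theorem ψ_condition (r : PivRel) (X : C) :
    (p.index.fst r).app X ≫ (p.ψ (pivShape.fst r)).app X =
      (p.index.snd r).app X ≫ (p.ψ (pivShape.snd r)).app X :=
  congrArg (fun t => t.app X) (Multicoequalizer.condition p.index r)

/-- A functor preserving colimits sends `T(X)` to the colimit of the images of the `F_w(X)`. -/
noncomputable def isColimitMapT (G : C ⥤ C) [PreservesColimitsOfSize.{0, 0} G] (X : C) :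
    IsColimit (((evaluation C C).obj X ⋙ G).mapCocone (colimit.cocone p.index.multispan)) :=
  isColimitOfPreserves _ (colimit.isColimit p.index.multispan)

theorem map_T_hom_ext (G : C ⥤ C) [PreservesColimitsOfSize.{0, 0} G] {X V : C}
    {f g : G.obj (p.T.obj X) ⟶ V}
    (h : ∀ w, G.map ((p.ψ w).app X) ≫ f = G.map ((p.ψ w).app X) ≫ g) : f = g := by
  refine (p.isColimitMapT G X).hom_ext ?_
  have hr : ∀ w, (((evaluation C C).obj X ⋙ G).mapCocone
      (colimit.cocone p.index.multispan)).ι.app (WalkingMultispan.right w) ≫ f =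
      (((evaluation C C).obj X ⋙ G).mapCocone
      (colimit.cocone p.index.multispan)).ι.app (WalkingMultispan.right w) ≫ g := h
  rintro (r | w)
  -- The leg at a relation factors through the leg at its first target word.
  · have e := (((evaluation C C).obj X ⋙ G).mapCocone
      (colimit.cocone p.index.multispan)).w (WalkingMultispan.Hom.fst r)
    exact (congrArg (· ≫ f) e.symm).trans ((Category.assoc _ _ _).trans
      ((congrArg (_ ≫ ·) (hr _)).trans ((Category.assoc _ _ _).symm.trans (congrArg (· ≫ g) e))))
  · exact hr w

variable {p} in
theorem T_hom_ext {X V : C} {f g : p.T.obj X ⟶ V}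
    (h : ∀ w, (p.ψ w).app X ≫ f = (p.ψ w).app X ≫ g) : f = g :=
  p.map_T_hom_ext (𝟭 C) h

/-- The component of `ψ_∅`. -/
noncomputable def ψNil (X : C) : X ⟶ p.T.obj X := (p.ψ []).app X

/-- The component of `ψ_{i, w}`. -/
noncomputable def ψCons (i : PivSign) (w : List PivSign) (X : C) :
    (p.F i).obj ((p.word w).obj X) ⟶ p.T.obj X :=
  (p.ψ (i :: w)).app X

variable {p} in
theorem T_induction {X V : C} {f g : p.T.obj X ⟶ V} (h : p.ψNil X ≫ f = p.ψNil X ≫ g)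
    (h' : ∀ i w, (p.ψ w).app X ≫ f = (p.ψ w).app X ≫ g → p.ψCons i w X ≫ f = p.ψCons i w X ≫ g) :
    f = g :=
  T_hom_ext fun w => List.rec (motive := fun w => (p.ψ w).app X ≫ f = (p.ψ w).app X ≫ g) h h' w

/-- `F_i` takes the relation with outer word `u` to the one with outer word `i :: u`. This is why
the diagram must contain the images of the pairs under all `F_u`. -/
theorem ψCons_condition (i : PivSign) (r : PivRel) (X : C) :
    (p.F i).map ((p.index.fst r).app X) ≫ p.ψCons i (pivShape.fst r) X =
      (p.F i).map ((p.index.snd r).app X) ≫ p.ψCons i (pivShape.snd r) X := by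
  obtain ⟨k, u, w⟩ := r
  have e : ∀ {A : C} {w : List PivSign} (f : A ⟶ (p.word w).obj X),
      (p.F i).map ((p.word u).map f ≫ (p.append u w).app X) =
        (p.word (i :: u)).map f ≫ (p.append (i :: u) w).app X := fun f =>
    ((p.F i).map_comp _ _).trans (congrArg (_ ≫ ·) (Category.id_comp _).symm)
  exact (congrArg (· ≫ _) (e (w := k.sign :: k.sign.neg :: w) (p.insertApp k _))).trans
    ((p.ψ_condition ⟨k, i :: u, w⟩ X).trans (congrArg (· ≫ _) (e (p.evalApp k _)).symm))

theorem exists_map_T_desc (G : C ⥤ C) [PreservesColimitsOfSize.{0, 0} G] {X V : C}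
    (k : ∀ w, G.obj ((p.word w).obj X) ⟶ V)
    (hk : ∀ r : PivRel, G.map ((p.index.fst r).app X) ≫ k (pivShape.fst r) =
      G.map ((p.index.snd r).app X) ≫ k (pivShape.snd r)) :
    ∃ h : G.obj (p.T.obj X) ⟶ V, ∀ w, G.map ((p.ψ w).app X) ≫ h = k w := by
  let c : Cocone (p.index.multispan ⋙ (evaluation C C).obj X ⋙ G) :=
    { pt := V
      ι :=
        { app := fun j => match j with
            | .left r => G.map ((p.index.fst r).app X) ≫ k (pivShape.fst r)
            | .right w => k w
          naturality := by
            rintro _ _ (_ | r | r)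
            · exact (congrArg (· ≫ _) ((p.index.multispan ⋙ (evaluation C C).obj X ⋙ G).map_id
                _)).trans ((Category.id_comp _).trans (Category.comp_id _).symm)
            · exact (Category.comp_id _).symm
            · exact (hk r).symm.trans (Category.comp_id _).symm } }
  exact ⟨(p.isColimitMapT G X).desc c, fun w =>
    (p.isColimitMapT G X).fac c (WalkingMultispan.right w)⟩

theorem ExtensionRule.exists_desc {p : PivotalPair C}
    [∀ X : C, HasColimit (p.index.multispan.flip.obj X)] {G : C ⥤ C}
    [PreservesColimitsOfSize.{0, 0} G] {V : C} (E : p.ExtensionRule G V) {X : C}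
    (g : G.obj X ⟶ V) :
    ∃ h : G.obj (p.T.obj X) ⟶ V, ∀ w, G.map ((p.ψ w).app X) ≫ h = E.iter g w :=
  p.exists_map_T_desc G (E.iter g) (E.fst_iter g)

variable {p}

namespace SignAction

theorem exists_lift (M : p.SignAction) {X : C} (f : X ⟶ M.obj) :
    ∃ h : p.T.obj X ⟶ M.obj, ∀ w, (p.ψ w).app X ≫ h = M.rule.iter (G := 𝟭 C) f w :=
  M.rule.exists_desc f

/-- The morphism out of the free action on `X` induced by `X ⟶ M`. -/
noncomputable def lift (M : p.SignAction) {X : C} (f : X ⟶ M.obj) : p.T.obj X ⟶ M.obj :=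
  (M.exists_lift f).choose

theorem ψ_lift (M : p.SignAction) {X : C} (f : X ⟶ M.obj) (w : List PivSign) :
    (p.ψ w).app X ≫ M.lift f = M.rule.iter (G := 𝟭 C) f w :=
  (M.exists_lift f).choose_spec w

theorem ψNil_lift (M : p.SignAction) {X : C} (f : X ⟶ M.obj) : p.ψNil X ≫ M.lift f = f :=
  M.ψ_lift f []

theorem ψCons_lift (M : p.SignAction) {X : C} (f : X ⟶ M.obj) (i : PivSign) (w : List PivSign) :
    p.ψCons i w X ≫ M.lift f = (p.F i).map ((p.ψ w).app X ≫ M.lift f) ≫ M.act i := by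
  rw [ψ_lift]
  exact M.ψ_lift f (i :: w)

end SignAction

end Colimit

variable [∀ X : C, PreservesColimitsOfSize.{0, 0} (tensorLeft X)]
    [∀ X : C, PreservesColimitsOfSize.{0, 0} (tensorRight X)]

instance preservesColimits_F (i : PivSign) : PreservesColimitsOfSize.{0, 0} (p.F i) := by
  cases i
  · exact comp_preservesColimits (tensorRight p.P) (tensorLeft p.Q)
  · exact comp_preservesColimits (tensorRight p.Q) (tensorLeft p.P)

instance preservesColimits_src (k : PivKind) : PreservesColimitsOfSize.{0, 0} (p.src k) := by
  cases k <;> exact comp_preservesColimits _ _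

instance preservesColimits_word : ∀ w, PreservesColimitsOfSize.{0, 0} (p.word w)
  | [] => inferInstanceAs (PreservesColimitsOfSize.{0, 0} (𝟭 C))
  | i :: w => by
    have := preservesColimits_word w
    exact comp_preservesColimits (p.word w) (p.F i)

variable [∀ X : C, HasColimit (p.index.multispan.flip.obj X)]

/-- `F_i` preserves colimits, so `F_i(T(X))` is the colimit of the `F_i(F_w(X))` and the `ψ_{i,w}`
form a cocone on it. -/
theorem exists_freeAct (i : PivSign) (X : C) : ∃ h : (p.F i).obj (p.T.obj X) ⟶ p.T.obj X,
    ∀ w, (p.F i).map ((p.ψ w).app X) ≫ h = p.ψCons i w X :=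
  p.exists_map_T_desc (p.F i) (fun w => p.ψCons i w X) fun r => p.ψCons_condition i r X

/-- The action of `F_±` on `T(X)`. -/
noncomputable def freeAct (i : PivSign) (X : C) : (p.F i).obj (p.T.obj X) ⟶ p.T.obj X :=
  (p.exists_freeAct i X).choose

theorem map_ψ_freeAct (i : PivSign) (w : List PivSign) (X : C) :
    (p.F i).map ((p.ψ w).app X) ≫ p.freeAct i X = p.ψCons i w X :=
  (p.exists_freeAct i X).choose_spec w

theorem insertApp_ψCons (k : PivKind) (w : List PivSign) (X : C) :
    p.insertApp k ((p.word w).obj X) ≫ (p.F k.sign).map (p.ψCons k.sign.neg w X) ≫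
      p.freeAct k.sign X = p.evalApp k ((p.word w).obj X) ≫ (p.ψ w).app X := by
  have h : (p.F k.sign).map (p.ψCons k.sign.neg w X) ≫ p.freeAct k.sign X =
    p.ψCons k.sign (k.sign.neg :: w) X := p.map_ψ_freeAct k.sign (k.sign.neg :: w) X
  rw [h]
  exact (congrArg (· ≫ _) (Category.comp_id _).symm).trans
    ((p.ψ_condition ⟨k, [], w⟩ X).trans (congrArg (· ≫ _) (Category.comp_id _)))

/-- `T(X)` is an object with actions of `F_±`. -/
noncomputable abbrev free (X : C) : p.SignAction where
  obj := p.T.obj X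
  act i := p.freeAct i X
  rel k := by
    -- The source functor of the pair preserves colimits, so the relation may be tested on each
    -- `F_w(X)`, where it is the diagram's relation with empty outer word.
    refine p.map_T_hom_ext (p.src k) fun w => ?_
    rw [reassoc_of% p.insertApp_naturality k, ← Functor.map_comp_assoc, map_ψ_freeAct,
      insertApp_ψCons, p.evalApp_naturality]

variable {p}

namespace SignAction

theorem isHom_lift (M : p.SignAction) {X : C} (f : X ⟶ M.obj) :
    (p.free X).IsHom M (M.lift f) := fun i => by
  refine p.map_T_hom_ext (p.F i) fun w => ?_
  rw [reassoc_of% map_ψ_freeAct, ψCons_lift, Functor.map_comp, Category.assoc]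

theorem ψCons_comp {M : p.SignAction} {X : C} {f : p.T.obj X ⟶ M.obj} (hf : (p.free X).IsHom M f)
    (i : PivSign) (w : List PivSign) :
    p.ψCons i w X ≫ f = (p.F i).map ((p.ψ w).app X ≫ f) ≫ M.act i := by
  rw [← map_ψ_freeAct, Category.assoc, Functor.map_comp, Category.assoc]
  exact congrArg _ (hf i).symm

/-- Morphisms out of a free action are determined by their restriction along `ψ_∅`. -/
theorem hom_ext {M : p.SignAction} {X : C} {f g : p.T.obj X ⟶ M.obj} (hf : (p.free X).IsHom M f)
    (hg : (p.free X).IsHom M g) (h : p.ψNil X ≫ f = p.ψNil X ≫ g) : f = g :=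
  T_induction h fun i w ih => by rw [ψCons_comp hf, ψCons_comp hg, ih]

theorem isHom_map {X Y : C} (f : X ⟶ Y) : (p.free X).IsHom (p.free Y) (p.T.map f) := fun i => by
  refine p.map_T_hom_ext (p.F i) fun w => ?_
  rw [reassoc_of% map_ψ_freeAct, ← Functor.map_comp_assoc, ← NatTrans.naturality,
    Functor.map_comp_assoc, map_ψ_freeAct]
  exact (p.ψ (i :: w)).naturality f

end SignAction

end PivotalPair

/-! ### The bimonad structure: existence, formulas and uniqueness -/

namespace PivotalPair

open PivSign Sandwich

variable {C : Type u} [Category.{v} C] [MonoidalCategory C] {p : PivotalPair C}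
    [∀ X : C, HasColimit (p.index.multispan.flip.obj X)]

theorem ψNil_naturality {X Y : C} (f : X ⟶ Y) : p.ψNil X ≫ p.T.map f = f ≫ p.ψNil Y :=
  ((p.ψ []).naturality f).symm

variable (p) in
/-- The counit of `T`. -/
noncomputable def counit : p.T.obj (𝟙_ C) ⟶ 𝟙_ C :=
  (SignAction.unit p).lift (𝟙 (𝟙_ C))

@[simp]
theorem ψNil_counit : p.ψNil (𝟙_ C) ≫ p.counit = 𝟙 (𝟙_ C) :=
  SignAction.ψNil_lift (SignAction.unit p) _

variable [∀ X : C, PreservesColimitsOfSize.{0, 0} (tensorLeft X)]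
    [∀ X : C, PreservesColimitsOfSize.{0, 0} (tensorRight X)]

variable (p)

/-- The multiplication of `T`. -/
noncomputable def mul (X : C) : p.T.obj (p.T.obj X) ⟶ p.T.obj X :=
  (p.free X).lift (𝟙 (p.T.obj X))

/-- The comonoidal structure of `T`. -/
noncomputable def comul (X Y : C) : p.T.obj (X ⊗ Y) ⟶ p.T.obj X ⊗ p.T.obj Y :=
  ((p.free X).tensor (p.free Y)).lift (p.ψNil X ⊗ₘ p.ψNil Y)

variable {p}

theorem isHom_mul (X : C) : (p.free (p.T.obj X)).IsHom (p.free X) (p.mul X) :=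
  SignAction.isHom_lift (p.free X) _

theorem isHom_comul (X Y : C) :
    (p.free (X ⊗ Y)).IsHom ((p.free X).tensor (p.free Y)) (p.comul X Y) :=
  SignAction.isHom_lift ((p.free X).tensor (p.free Y)) _

theorem isHom_counit : (p.free (𝟙_ C)).IsHom (SignAction.unit p) p.counit :=
  SignAction.isHom_lift (SignAction.unit p) _

@[simp]
theorem ψNil_mul (X : C) : p.ψNil (p.T.obj X) ≫ p.mul X = 𝟙 (p.T.obj X) :=
  SignAction.ψNil_lift (p.free X) _

@[simp]
theorem ψNil_comul (X Y : C) : p.ψNil (X ⊗ Y) ≫ p.comul X Y = p.ψNil X ⊗ₘ p.ψNil Y :=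
  SignAction.ψNil_lift ((p.free X).tensor (p.free Y)) _

open SignAction

/-- The pattern of all the axioms below: both sides are action morphisms out of a free action, hence
are compared along `ψ_∅` only. -/
theorem comul_naturality {X X' Y Y' : C} (f : X ⟶ X') (g : Y ⟶ Y') :
    p.comul X Y ≫ (p.T.map f ⊗ₘ p.T.map g) = p.T.map (f ⊗ₘ g) ≫ p.comul X' Y' :=
  hom_ext ((isHom_comul X Y).comp ((isHom_map f).tensor (isHom_map g)))
    ((isHom_map (f ⊗ₘ g)).comp (isHom_comul X' Y')) (by
      rw [reassoc_of% ψNil_comul, reassoc_of% ψNil_naturality, ψNil_comul,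
        MonoidalCategory.tensorHom_comp_tensorHom, MonoidalCategory.tensorHom_comp_tensorHom,
        ψNil_naturality, ψNil_naturality])

theorem comul_associativity (X Y Z : C) :
    p.comul (X ⊗ Y) Z ≫ (p.comul X Y ⊗ₘ 𝟙 (p.T.obj Z)) ≫
      (α_ (p.T.obj X) (p.T.obj Y) (p.T.obj Z)).hom =
        p.T.map (α_ X Y Z).hom ≫ p.comul X (Y ⊗ Z) ≫ (𝟙 (p.T.obj X) ⊗ₘ p.comul Y Z) :=
  hom_ext
    ((isHom_comul (X ⊗ Y) Z).comp (((isHom_comul X Y).tensor (IsHom.id (p.free Z))).comp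
      (isHom_associator (p.free X) (p.free Y) (p.free Z))))
    ((isHom_map (α_ X Y Z).hom).comp ((isHom_comul X (Y ⊗ Z)).comp
      ((IsHom.id (p.free X)).tensor (isHom_comul Y Z)))) (by
      rw [reassoc_of% ψNil_comul, MonoidalCategory.tensorHom_comp_tensorHom_assoc, ψNil_comul,
        Category.comp_id, reassoc_of% ψNil_naturality, reassoc_of% ψNil_comul,
        MonoidalCategory.tensorHom_comp_tensorHom, ψNil_comul, Category.comp_id,
        MonoidalCategory.associator_naturality])

theorem comul_leftUnitor (X : C) :
    p.comul (𝟙_ C) X ≫ (p.counit ⊗ₘ 𝟙 (p.T.obj X)) ≫ (λ_ (p.T.obj X)).hom =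
      p.T.map (λ_ X).hom :=
  hom_ext
    ((isHom_comul (𝟙_ C) X).comp ((isHom_counit.tensor (IsHom.id (p.free X))).comp
      (isHom_leftUnitor (p.free X)))) (isHom_map _) (by
      rw [reassoc_of% ψNil_comul, MonoidalCategory.tensorHom_comp_tensorHom_assoc, ψNil_counit,
        ψNil_naturality, Category.comp_id, MonoidalCategory.id_tensorHom,
        MonoidalCategory.leftUnitor_naturality])

theorem comul_rightUnitor (X : C) :
    p.comul X (𝟙_ C) ≫ (𝟙 (p.T.obj X) ⊗ₘ p.counit) ≫ (ρ_ (p.T.obj X)).hom =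
      p.T.map (ρ_ X).hom :=
  hom_ext
    ((isHom_comul X (𝟙_ C)).comp (((IsHom.id (p.free X)).tensor isHom_counit).comp
      (isHom_rightUnitor (p.free X)))) (isHom_map _) (by
      rw [reassoc_of% ψNil_comul, MonoidalCategory.tensorHom_comp_tensorHom_assoc, ψNil_counit,
        ψNil_naturality, Category.comp_id, MonoidalCategory.tensorHom_id,
        MonoidalCategory.rightUnitor_naturality])

variable (p)

/-- The comonoidal structure of `T` as an oplax monoidal functor. -/
noncomputable abbrev oplaxT : p.T.OplaxMonoidal where
  η := p.counit
  δ := p.comul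
  δ_natural_left f Y := by
    have h := comul_naturality (p := p) f (𝟙 Y)
    simpa using h
  δ_natural_right X f := by
    have h := comul_naturality (p := p) (𝟙 X) f
    simpa using h
  oplax_associativity X Y Z := by
    simpa using comul_associativity (p := p) X Y Z
  oplax_left_unitality X := by
    rw [← cancel_mono (λ_ (p.T.obj X)).hom, Iso.inv_hom_id, Category.assoc, Category.assoc,
      ← MonoidalCategory.tensorHom_id, comul_leftUnitor, ← Functor.map_comp, Iso.inv_hom_id,
      CategoryTheory.Functor.map_id]
  oplax_right_unitality X := by
    rw [← cancel_mono (ρ_ (p.T.obj X)).hom, Iso.inv_hom_id, Category.assoc, Category.assoc,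
      ← MonoidalCategory.id_tensorHom, comul_rightUnitor, ← Functor.map_comp, Iso.inv_hom_id,
      CategoryTheory.Functor.map_id]

variable {p}

theorem mul_naturality {X Y : C} (f : X ⟶ Y) :
    p.T.map (p.T.map f) ≫ p.mul Y = p.mul X ≫ p.T.map f :=
  hom_ext ((isHom_map _).comp (isHom_mul Y)) ((isHom_mul X).comp (isHom_map f)) (by
    rw [reassoc_of% ψNil_naturality, ψNil_mul, reassoc_of% ψNil_mul, Category.comp_id])

theorem map_mul_mul (X : C) :
    p.T.map (p.mul X) ≫ p.mul X = p.mul (p.T.obj X) ≫ p.mul X :=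
  hom_ext ((isHom_map _).comp (isHom_mul X)) ((isHom_mul (p.T.obj X)).comp (isHom_mul X)) (by
    rw [reassoc_of% ψNil_naturality, ψNil_mul, reassoc_of% ψNil_mul, Category.comp_id])

theorem mul_comp_comul (X Y : C) :
    p.mul (X ⊗ Y) ≫ p.comul X Y = p.T.map (p.comul X Y) ≫ p.comul (p.T.obj X) (p.T.obj Y) ≫
      (p.mul X ⊗ₘ p.mul Y) :=
  hom_ext ((isHom_mul (X ⊗ Y)).comp (isHom_comul X Y))
    ((isHom_map _).comp ((isHom_comul _ _).comp ((isHom_mul X).tensor (isHom_mul Y)))) (by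
      rw [reassoc_of% ψNil_mul, reassoc_of% ψNil_naturality, reassoc_of% ψNil_comul,
        MonoidalCategory.tensorHom_comp_tensorHom, ψNil_mul, ψNil_mul,
        MonoidalCategory.id_tensorHom_id, Category.comp_id])

theorem mul_comp_counit : p.mul (𝟙_ C) ≫ p.counit = p.T.map p.counit ≫ p.counit :=
  hom_ext ((isHom_mul _).comp isHom_counit) ((isHom_map _).comp isHom_counit) (by
    rw [reassoc_of% ψNil_mul, reassoc_of% ψNil_naturality, ψNil_counit, Category.comp_id])

theorem map_ψNil_mul (X : C) : p.T.map (p.ψNil X) ≫ p.mul X = 𝟙 (p.T.obj X) :=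
  hom_ext ((isHom_map (p.ψNil X)).comp (isHom_mul X)) (IsHom.id _) (by
    rw [reassoc_of% ψNil_naturality, ψNil_mul])

variable (p)

/-- The bimonad structure of `T`. -/
noncomputable def bimonad : BimonadOn p.T where
  unit := p.ψ []
  mul :=
    { app := p.mul
      naturality := fun _ _ f => mul_naturality f }
  mul_assoc := map_mul_mul
  left_unit := ψNil_mul
  right_unit := map_ψNil_mul
  oplax := p.oplaxT
  mul_comul := mul_comp_comul
  unit_comul := ψNil_comul
  mul_counit := mul_comp_counit
  unit_counit := ψNil_counit

/-- The multiplication is an action morphism, so on `F_w(T(X))` it is the iterated free action. With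
`map_ψ_iter_free` this gives the concatenation formula. -/
theorem ψ_comp_mul (w : List PivSign) (X : C) :
    (p.ψ w).app (p.T.obj X) ≫ p.mul X = (p.free X).iter w := by
  induction w with
  | nil => exact ψNil_mul X
  | cons i w ih =>
    refine (ψCons_comp (isHom_mul X) i w).trans ?_
    rw [ih]
    rfl

theorem map_ψ_iter_free (w v : List PivSign) (X : C) :
    (p.word w).map ((p.ψ v).app X) ≫ (p.free X).iter w =
      (p.append w v).app X ≫ (p.ψ (w ++ v)).app X := by
  induction w with
  | nil => exact (Category.comp_id _).trans (Category.id_comp _).symm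
  | cons i w ih =>
    have e : (p.append (i :: w) v).app X = (p.F i).map ((p.append w v).app X) :=
      Category.id_comp _
    rw [e]
    change (p.F i).map ((p.word w).map ((p.ψ v).app X)) ≫ (p.F i).map ((p.free X).iter w) ≫
      p.freeAct i X = _ ≫ p.ψCons i (w ++ v) X
    rw [← Functor.map_comp_assoc, ih, ← map_ψ_freeAct]
    exact (congrArg (· ≫ _) ((p.F i).map_comp _ _)).trans (Category.assoc _ _ _)

theorem ψ_comul (w : List PivSign) (X Y : C) :
    (p.ψ w).app (X ⊗ Y) ≫ p.comul X Y =
      p.splitWord w X Y ≫ ((p.ψ w).app X ⊗ₘ (p.ψ w).app Y) := by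
  induction w with
  | nil => exact (ψNil_comul X Y).trans (Category.id_comp _).symm
  | cons i w ih =>
    refine (ψCons_comp (isHom_comul X Y) i w).trans ?_
    rw [ih]
    change _ ≫ p.splitSign i _ _ ≫ (p.freeAct i X ⊗ₘ p.freeAct i Y) =
      ((p.F i).map (p.splitWord w X Y) ≫ p.splitSign i _ _) ≫ (p.ψCons i w X ⊗ₘ p.ψCons i w Y)
    rw [Functor.map_comp, Category.assoc, reassoc_of% splitSign_naturality (p := p) i,
      MonoidalCategory.tensorHom_comp_tensorHom, map_ψ_freeAct, map_ψ_freeAct, Category.assoc]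

theorem ψ_counit (w : List PivSign) : (p.ψ w).app (𝟙_ C) ≫ p.counit = p.evWord w := by
  induction w with
  | nil => exact ψNil_counit
  | cons i w ih =>
    refine (ψCons_comp isHom_counit i w).trans ?_
    rw [ih]
    rfl

theorem isStandard_bimonad : p.IsStandard p.bimonad where
  unit_eq := rfl
  mul_eq w v X := by
    rw [← map_ψ_iter_free, ← ψ_comp_mul]
    rfl
  comul_eq := p.ψ_comul
  counit_eq := p.ψ_counit

variable {p} in
theorem IsStandard.eq {B B' : BimonadOn p.T} (h : p.IsStandard B) (h' : p.IsStandard B') :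
    B = B' := by
  have hm : B.mul = B'.mul := by
    ext X
    -- `F_w` preserves colimits, so the composites of `F_w(ψ_v)` and `ψ_w` are jointly epic on
    -- `T(T(X))`.
    refine T_hom_ext fun w => p.map_T_hom_ext (p.word w) fun v => ?_
    rw [h.mul_eq, h'.mul_eq]
  have hc : ∀ X Y, B.oplax.δ X Y = B'.oplax.δ X Y := fun X Y =>
    T_hom_ext fun w => by rw [h.comul_eq, h'.comul_eq]
  have hn : B.oplax.η = B'.oplax.η := T_hom_ext fun w => by rw [h.counit_eq, h'.counit_eq]
  have hu : B.unit = B'.unit := h.unit_eq.trans h'.unit_eq.symm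
  obtain ⟨_, _, _, _, _, ⟨_, _⟩, _⟩ := B
  obtain ⟨_, _, _, _, _, ⟨_, _⟩, _⟩ := B'
  obtain rfl := hm
  obtain rfl := hu
  obtain rfl := hn
  obtain rfl := funext₂ hc
  rfl

end PivotalPair

/-! ### Inverses of the fusion operators -/

namespace PivotalPair

open PivSign Sandwich SignAction

variable {C : Type u} [Category.{v} C] [MonoidalCategory C] {p : PivotalPair C}

theorem splitSign_ruleRight (Z V : p.SignAction) (i : PivSign) (A : C) (g : A ⊗ Z.obj ⟶ V.obj) :
    p.splitSign i A Z.obj ≫ (p.F i).obj A ◁ Z.act i ≫ (Z.ruleRight V).next i A g =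
      (p.F i).map g ≫ V.act i := by
  cases i
  · exact split_transposeRight Z.compatible_minus g
  · exact split_transposeRight Z.compatible_plus g

theorem splitSign_ruleLeft (Z V : p.SignAction) (i : PivSign) (A : C) (g : Z.obj ⊗ A ⟶ V.obj) :
    p.splitSign i Z.obj A ≫ Z.act i ▷ (p.F i).obj A ≫ (Z.ruleLeft V).next i A g =
      (p.F i).map g ≫ V.act i := by
  cases i
  · exact split_transposeLeft Z.compatible_minus g
  · exact split_transposeLeft Z.compatible_plus g

theorem ruleRight_tensor (Z M : p.SignAction) (i : PivSign) {A : C} (f : A ⟶ M.obj) :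
    (Z.ruleRight (M.tensor Z)).next i A (f ▷ Z.obj) = ((p.F i).map f ≫ M.act i) ▷ Z.obj := by
  cases i
  · exact transposeRight_tensorAct Z.compatible_plus (M.act plus) f
  · exact transposeRight_tensorAct Z.compatible_minus (M.act minus) f

theorem ruleLeft_tensor (Z M : p.SignAction) (i : PivSign) {A : C} (f : A ⟶ M.obj) :
    (Z.ruleLeft (Z.tensor M)).next i A (Z.obj ◁ f) = Z.obj ◁ ((p.F i).map f ≫ M.act i) := by
  cases i
  · exact transposeLeft_tensorAct Z.compatible_plus (M.act plus) f
  · exact transposeLeft_tensorAct Z.compatible_minus (M.act minus) f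

theorem ruleRight_comp (Z : p.SignAction) {V W : p.SignAction} {h : V.obj ⟶ W.obj}
    (hh : V.IsHom W h) (i : PivSign) (A : C) (g : A ⊗ Z.obj ⟶ V.obj) :
    (Z.ruleRight V).next i A g ≫ h = (Z.ruleRight W).next i A (g ≫ h) := by
  simp only [ruleRight, Functor.map_comp, Category.assoc, hh i]

theorem ruleLeft_comp (Z : p.SignAction) {V W : p.SignAction} {h : V.obj ⟶ W.obj}
    (hh : V.IsHom W h) (i : PivSign) (A : C) (g : Z.obj ⊗ A ⟶ V.obj) :
    (Z.ruleLeft V).next i A g ≫ h = (Z.ruleLeft W).next i A (g ≫ h) := by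
  simp only [ruleLeft, Functor.map_comp, Category.assoc, hh i]

variable [∀ X : C, HasColimit (p.index.multispan.flip.obj X)]
    [∀ X : C, PreservesColimitsOfSize.{0, 0} (tensorLeft X)]
    [∀ X : C, PreservesColimitsOfSize.{0, 0} (tensorRight X)]

/-! ### The left fusion operator -/

theorem exists_fusionInvRight (Z : p.SignAction) (X : C) :
    ∃ h : p.T.obj X ⊗ Z.obj ⟶ p.T.obj (X ⊗ Z.obj), ∀ w, (p.ψ w).app X ▷ Z.obj ≫ h =
      (Z.ruleRight (p.free (X ⊗ Z.obj))).iter (G := tensorRight Z.obj) (p.ψNil (X ⊗ Z.obj)) w :=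
  (Z.ruleRight (p.free (X ⊗ Z.obj))).exists_desc (G := tensorRight Z.obj) (p.ψNil (X ⊗ Z.obj))

/-- The inverse `T(X) ⊗ Z ⟶ T(X ⊗ Z)` of the fusion operator of an action on `Z`. -/
noncomputable def fusionInvRight (Z : p.SignAction) (X : C) :
    p.T.obj X ⊗ Z.obj ⟶ p.T.obj (X ⊗ Z.obj) :=
  (exists_fusionInvRight Z X).choose

theorem ψ_fusionInvRight (Z : p.SignAction) (X : C) (w : List PivSign) :
    (p.ψ w).app X ▷ Z.obj ≫ fusionInvRight Z X =
      (Z.ruleRight (p.free (X ⊗ Z.obj))).iter (G := tensorRight Z.obj) (p.ψNil (X ⊗ Z.obj)) w :=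
  (exists_fusionInvRight Z X).choose_spec w

theorem ψNil_fusionInvRight (Z : p.SignAction) (X : C) :
    p.ψNil X ▷ Z.obj ≫ fusionInvRight Z X = p.ψNil (X ⊗ Z.obj) :=
  ψ_fusionInvRight Z X []

theorem ψCons_fusionInvRight (Z : p.SignAction) (X : C) (i : PivSign) (w : List PivSign) :
    p.ψCons i w X ▷ Z.obj ≫ fusionInvRight Z X =
      (Z.ruleRight (p.free (X ⊗ Z.obj))).next i _
        ((p.ψ w).app X ▷ Z.obj ≫ fusionInvRight Z X) := by
  rw [ψ_fusionInvRight]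
  exact ψ_fusionInvRight Z X (i :: w)

instance preservesColimits_comp_F (G : C ⥤ C) [PreservesColimitsOfSize.{0, 0} G] (i : PivSign) :
    PreservesColimitsOfSize.{0, 0} (G ⋙ p.F i) :=
  comp_preservesColimits G (p.F i)

/-- Tested on `F_i(F_w(X) ⊗ Z)`, the claim is `splitSign_ruleRight`: the tensor action cancels the
exchange in the transposition. -/
theorem isHom_fusionInvRight (Z : p.SignAction) (X : C) :
    ((p.free X).tensor Z).IsHom (p.free (X ⊗ Z.obj)) (fusionInvRight Z X) := fun i => by
  refine p.map_T_hom_ext (tensorRight Z.obj ⋙ p.F i) fun w => ?_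
  change (p.F i).map ((p.ψ w).app X ▷ Z.obj) ≫ _ ≫ p.freeAct i _ =
    (p.F i).map ((p.ψ w).app X ▷ Z.obj) ≫
      (p.splitSign i _ _ ≫ (p.freeAct i X ⊗ₘ Z.act i)) ≫ fusionInvRight Z X
  have h := splitSign_ruleRight Z (p.free (X ⊗ Z.obj)) i _
    ((p.ψ w).app X ▷ Z.obj ≫ fusionInvRight Z X)
  rw [← ψCons_fusionInvRight, Functor.map_comp, Category.assoc] at h
  have e : (p.F i).map ((p.ψ w).app X ▷ Z.obj) ≫ p.splitSign i _ _ ≫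
      (p.freeAct i X ⊗ₘ Z.act i) = p.splitSign i _ _ ≫ (p.ψCons i w X ⊗ₘ Z.act i) := by
    rw [← MonoidalCategory.tensorHom_id, reassoc_of% splitSign_naturality (p := p) i,
      MonoidalCategory.tensorHom_comp_tensorHom, map_ψ_freeAct, CategoryTheory.Functor.map_id,
      Category.id_comp]
  rw [← h, Category.assoc, reassoc_of% e, MonoidalCategory.tensorHom_def', Category.assoc]

/-- The source `T(X ⊗ Z)` is free and the composite restricts to `ψ_∅`, so freeness gives the
identity. -/
theorem fusionRight_inv (Z : p.SignAction) {X : C} {H : p.T.obj (X ⊗ Z.obj) ⟶ p.T.obj X ⊗ Z.obj}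
    (hH : (p.free (X ⊗ Z.obj)).IsHom ((p.free X).tensor Z) H)
    (h : p.ψNil (X ⊗ Z.obj) ≫ H = p.ψNil X ▷ Z.obj) : H ≫ fusionInvRight Z X = 𝟙 _ :=
  hom_ext (hH.comp (isHom_fusionInvRight Z X)) (IsHom.id _) (by
    rw [reassoc_of% h, ψNil_fusionInvRight, Category.comp_id])

/-- The source `T(X) ⊗ Z` is not given as a free action, so this composite is computed by induction
on words. `H` passes through each transposition, and `ruleRight_tensor` evaluates the result. -/
theorem fusionInvRight_comp (Z : p.SignAction) {X : C}
    {H : p.T.obj (X ⊗ Z.obj) ⟶ p.T.obj X ⊗ Z.obj}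
    (hH : (p.free (X ⊗ Z.obj)).IsHom ((p.free X).tensor Z) H)
    (h : p.ψNil (X ⊗ Z.obj) ≫ H = p.ψNil X ▷ Z.obj) : fusionInvRight Z X ≫ H = 𝟙 _ := by
  refine p.map_T_hom_ext (tensorRight Z.obj) fun w => ?_
  change (p.ψ w).app X ▷ Z.obj ≫ _ = (p.ψ w).app X ▷ Z.obj ≫ _
  rw [Category.comp_id]
  induction w with
  | nil =>
    change p.ψNil X ▷ Z.obj ≫ _ = p.ψNil X ▷ Z.obj
    rw [reassoc_of% ψNil_fusionInvRight, h]
  | cons i w ih =>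
    change p.ψCons i w X ▷ Z.obj ≫ _ = p.ψCons i w X ▷ Z.obj
    rw [reassoc_of% ψCons_fusionInvRight, ruleRight_comp Z hH, Category.assoc, ih,
      ruleRight_tensor, map_ψ_freeAct]

/-! ### The right fusion operator -/

theorem exists_fusionInvLeft (Z : p.SignAction) (X : C) :
    ∃ h : Z.obj ⊗ p.T.obj X ⟶ p.T.obj (Z.obj ⊗ X), ∀ w, Z.obj ◁ (p.ψ w).app X ≫ h =
      (Z.ruleLeft (p.free (Z.obj ⊗ X))).iter (G := tensorLeft Z.obj) (p.ψNil (Z.obj ⊗ X)) w :=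
  (Z.ruleLeft (p.free (Z.obj ⊗ X))).exists_desc (G := tensorLeft Z.obj) (p.ψNil (Z.obj ⊗ X))

/-- The inverse `Z ⊗ T(X) ⟶ T(Z ⊗ X)` of the fusion operator of an action on `Z`. -/
noncomputable def fusionInvLeft (Z : p.SignAction) (X : C) :
    Z.obj ⊗ p.T.obj X ⟶ p.T.obj (Z.obj ⊗ X) :=
  (exists_fusionInvLeft Z X).choose

theorem ψ_fusionInvLeft (Z : p.SignAction) (X : C) (w : List PivSign) :
    Z.obj ◁ (p.ψ w).app X ≫ fusionInvLeft Z X =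
      (Z.ruleLeft (p.free (Z.obj ⊗ X))).iter (G := tensorLeft Z.obj) (p.ψNil (Z.obj ⊗ X)) w :=
  (exists_fusionInvLeft Z X).choose_spec w

theorem ψNil_fusionInvLeft (Z : p.SignAction) (X : C) :
    Z.obj ◁ p.ψNil X ≫ fusionInvLeft Z X = p.ψNil (Z.obj ⊗ X) :=
  ψ_fusionInvLeft Z X []

theorem ψCons_fusionInvLeft (Z : p.SignAction) (X : C) (i : PivSign) (w : List PivSign) :
    Z.obj ◁ p.ψCons i w X ≫ fusionInvLeft Z X =
      (Z.ruleLeft (p.free (Z.obj ⊗ X))).next i _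
        (Z.obj ◁ (p.ψ w).app X ≫ fusionInvLeft Z X) := by
  rw [ψ_fusionInvLeft]
  exact ψ_fusionInvLeft Z X (i :: w)

theorem isHom_fusionInvLeft (Z : p.SignAction) (X : C) :
    (Z.tensor (p.free X)).IsHom (p.free (Z.obj ⊗ X)) (fusionInvLeft Z X) := fun i => by
  refine p.map_T_hom_ext (tensorLeft Z.obj ⋙ p.F i) fun w => ?_
  change (p.F i).map (Z.obj ◁ (p.ψ w).app X) ≫ _ ≫ p.freeAct i _ =
    (p.F i).map (Z.obj ◁ (p.ψ w).app X) ≫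
      (p.splitSign i _ _ ≫ (Z.act i ⊗ₘ p.freeAct i X)) ≫ fusionInvLeft Z X
  have h := splitSign_ruleLeft Z (p.free (Z.obj ⊗ X)) i _
    (Z.obj ◁ (p.ψ w).app X ≫ fusionInvLeft Z X)
  rw [← ψCons_fusionInvLeft, Functor.map_comp, Category.assoc] at h
  have e : (p.F i).map (Z.obj ◁ (p.ψ w).app X) ≫ p.splitSign i _ _ ≫
      (Z.act i ⊗ₘ p.freeAct i X) = p.splitSign i _ _ ≫ (Z.act i ⊗ₘ p.ψCons i w X) := by
    rw [← MonoidalCategory.id_tensorHom, reassoc_of% splitSign_naturality (p := p) i,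
      MonoidalCategory.tensorHom_comp_tensorHom, map_ψ_freeAct, CategoryTheory.Functor.map_id,
      Category.id_comp]
  rw [← h, Category.assoc, reassoc_of% e, MonoidalCategory.tensorHom_def, Category.assoc]

theorem fusionLeft_inv (Z : p.SignAction) {X : C} {H : p.T.obj (Z.obj ⊗ X) ⟶ Z.obj ⊗ p.T.obj X}
    (hH : (p.free (Z.obj ⊗ X)).IsHom (Z.tensor (p.free X)) H)
    (h : p.ψNil (Z.obj ⊗ X) ≫ H = Z.obj ◁ p.ψNil X) : H ≫ fusionInvLeft Z X = 𝟙 _ :=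
  hom_ext (hH.comp (isHom_fusionInvLeft Z X)) (IsHom.id _) (by
    rw [reassoc_of% h, ψNil_fusionInvLeft, Category.comp_id])

theorem fusionInvLeft_comp (Z : p.SignAction) {X : C}
    {H : p.T.obj (Z.obj ⊗ X) ⟶ Z.obj ⊗ p.T.obj X}
    (hH : (p.free (Z.obj ⊗ X)).IsHom (Z.tensor (p.free X)) H)
    (h : p.ψNil (Z.obj ⊗ X) ≫ H = Z.obj ◁ p.ψNil X) : fusionInvLeft Z X ≫ H = 𝟙 _ := by
  refine p.map_T_hom_ext (tensorLeft Z.obj) fun w => ?_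
  change Z.obj ◁ (p.ψ w).app X ≫ _ = Z.obj ◁ (p.ψ w).app X ≫ _
  rw [Category.comp_id]
  induction w with
  | nil =>
    change Z.obj ◁ p.ψNil X ≫ _ = Z.obj ◁ p.ψNil X
    rw [reassoc_of% ψNil_fusionInvLeft, h]
  | cons i w ih =>
    change Z.obj ◁ p.ψCons i w X ≫ _ = Z.obj ◁ p.ψCons i w X
    rw [reassoc_of% ψCons_fusionInvLeft, ruleLeft_comp Z hH, Category.assoc, ih,
      ruleLeft_tensor, map_ψ_freeAct]

/-! ### The formulas for the inverses -/

theorem isHom_leftFusion (X Y : C) : (p.free (X ⊗ p.T.obj Y)).IsHom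
    ((p.free X).tensor (p.free Y)) (p.comul X (p.T.obj Y) ≫ p.T.obj X ◁ p.mul Y) := by
  rw [← MonoidalCategory.id_tensorHom]
  exact (isHom_comul X (p.T.obj Y)).comp ((IsHom.id (p.free X)).tensor (isHom_mul Y))

theorem ψNil_leftFusion (X Y : C) : p.ψNil (X ⊗ p.T.obj Y) ≫
    p.comul X (p.T.obj Y) ≫ p.T.obj X ◁ p.mul Y = p.ψNil X ▷ p.T.obj Y := by
  rw [reassoc_of% ψNil_comul, ← MonoidalCategory.id_tensorHom,
    MonoidalCategory.tensorHom_comp_tensorHom, ψNil_mul, Category.comp_id,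
    MonoidalCategory.tensorHom_id]

theorem isHom_rightFusion (X Y : C) : (p.free (p.T.obj X ⊗ Y)).IsHom
    ((p.free X).tensor (p.free Y)) (p.comul (p.T.obj X) Y ≫ p.mul X ▷ p.T.obj Y) := by
  rw [← MonoidalCategory.tensorHom_id]
  exact (isHom_comul (p.T.obj X) Y).comp ((isHom_mul X).tensor (IsHom.id (p.free Y)))

theorem ψNil_rightFusion (X Y : C) : p.ψNil (p.T.obj X ⊗ Y) ≫
    p.comul (p.T.obj X) Y ≫ p.mul X ▷ p.T.obj Y = p.T.obj X ◁ p.ψNil Y := by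
  rw [reassoc_of% ψNil_comul, ← MonoidalCategory.tensorHom_id,
    MonoidalCategory.tensorHom_comp_tensorHom, ψNil_mul, Category.comp_id,
    MonoidalCategory.id_tensorHom]

theorem map_comp_freeAct (i : PivSign) (w : List PivSign) {A B X : C} (f : A ⟶ B)
    (g : B ⟶ (p.word w).obj X) :
    (p.F i).map (f ≫ g ≫ (p.ψ w).app X) ≫ p.freeAct i X =
      (p.F i).map f ≫ (p.F i).map g ≫ p.ψCons i w X := by
  rw [Functor.map_comp, Functor.map_comp, Category.assoc, Category.assoc, map_ψ_freeAct]

/-- Removing the first letter `i` from `w` lets `F_{-i}` act on `T(Y)`, which puts `-i` in front of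
`v`. Hence `v` varies in the induction and the index `revNeg w v` appears. -/
theorem ψ_fusionInvRight_free (X Y : C) (w v : List PivSign) :
    (p.word w).obj X ◁ (p.ψ v).app Y ≫ (p.ψ w).app X ▷ p.T.obj Y ≫ fusionInvRight (p.free Y) X =
      p.absorbRightWord w v X Y ≫ (p.word w).map (X ◁ (p.ψ (revNeg w v)).app Y) ≫
        (p.ψ w).app (X ⊗ p.T.obj Y) := by
  induction w generalizing v with
  | nil =>
    refine (congrArg (_ ≫ ·) (ψNil_fusionInvRight (p.free Y) X)).trans ?_
    exact (Category.id_comp _).symm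
  | cons i w ih =>
    refine (congrArg (_ ≫ ·) (ψCons_fusionInvRight (p.free Y) X i w)).trans ?_
    change (p.F i).obj ((p.word w).obj X) ◁ (p.ψ v).app Y ≫ p.absorbRightSign i _ (p.T.obj Y) ≫
      (p.F i).map ((p.word w).obj X ◁ p.freeAct i.neg Y ≫ _) ≫ p.freeAct i _ =
      (p.absorbRightSign i _ _ ≫ (p.F i).map (p.absorbRightWord w (i.neg :: v) X Y)) ≫
        (p.F i).map ((p.word w).map _) ≫ p.ψCons i w _
    have e := ih (i.neg :: v)
    change _ ◁ p.ψCons i.neg v Y ≫ _ = _ at e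
    rw [reassoc_of% absorbRightSign_naturality p i, ← Functor.map_comp_assoc,
      ← MonoidalCategory.whiskerLeft_comp_assoc, map_ψ_freeAct, e]
    exact (congrArg (_ ≫ ·) (map_comp_freeAct i _ _ _)).trans (Category.assoc _ _ _).symm

theorem ψ_fusionInvLeft_free (X Y : C) (w v : List PivSign) :
    (p.ψ w).app X ▷ (p.word v).obj Y ≫ p.T.obj X ◁ (p.ψ v).app Y ≫ fusionInvLeft (p.free X) Y =
      p.absorbLeftWord w v X Y ≫ (p.word v).map ((p.ψ (revNeg v w)).app X ▷ Y) ≫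
        (p.ψ v).app (p.T.obj X ⊗ Y) := by
  induction v generalizing w with
  | nil =>
    refine (congrArg (_ ≫ ·) (ψNil_fusionInvLeft (p.free X) Y)).trans ?_
    exact (congrArg (· ≫ _) (by cases w <;> rfl)).trans (Category.id_comp _).symm
  | cons i v ih =>
    refine (congrArg (_ ≫ ·) (ψCons_fusionInvLeft (p.free X) Y i v)).trans ?_
    have hw : p.absorbLeftWord w (i :: v) X Y = p.absorbLeftSign i _ _ ≫
      (p.F i).map (p.absorbLeftWord (i.neg :: w) v X Y) := by cases w <;> rfl
    rw [hw]
    change (p.ψ w).app X ▷ (p.F i).obj ((p.word v).obj Y) ≫ p.absorbLeftSign i (p.T.obj X) _ ≫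
      (p.F i).map (p.freeAct i.neg X ▷ (p.word v).obj Y ≫ _) ≫ p.freeAct i _ =
      (p.absorbLeftSign i _ _ ≫ (p.F i).map (p.absorbLeftWord (i.neg :: w) v X Y)) ≫
        (p.F i).map ((p.word v).map _) ≫ p.ψCons i v _
    have e := ih (i.neg :: w)
    change p.ψCons i.neg w X ▷ _ ≫ _ = _ at e
    rw [reassoc_of% absorbLeftSign_naturality p i, ← Functor.map_comp_assoc,
      ← comp_whiskerRight_assoc, map_ψ_freeAct, e]
    exact (congrArg (_ ≫ ·) (map_comp_freeAct i _ _ _)).trans (Category.assoc _ _ _).symm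

theorem isLeftInverseFormula (X Y : C) :
    p.IsLeftInverseFormula X Y (fusionInvRight (p.free Y) X) := fun w v => by
  rw [MonoidalCategory.tensorHom_def', Category.assoc]
  exact ψ_fusionInvRight_free X Y w v

theorem isRightInverseFormula (X Y : C) :
    p.IsRightInverseFormula X Y (fusionInvLeft (p.free X) Y) := fun w v => by
  rw [MonoidalCategory.tensorHom_def, Category.assoc]
  exact ψ_fusionInvLeft_free X Y w v

theorem T_tensor_hom_ext {X Y V : C} {f g : p.T.obj X ⊗ p.T.obj Y ⟶ V}
    (h : ∀ w v, ((p.ψ w).app X ⊗ₘ (p.ψ v).app Y) ≫ f = ((p.ψ w).app X ⊗ₘ (p.ψ v).app Y) ≫ g) :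
    f = g := by
  refine p.map_T_hom_ext (tensorLeft (p.T.obj X)) fun v =>
    p.map_T_hom_ext (tensorRight ((p.word v).obj Y)) fun w => ?_
  have e := h w v
  rw [MonoidalCategory.tensorHom_def, Category.assoc, Category.assoc] at e
  exact e

end PivotalPair

namespace PivotalPair

open PivSign Sandwich SignAction

variable {C : Type u} [Category.{v} C] [MonoidalCategory C] {p : PivotalPair C}

/-! ### Actions and intertwined objects -/

/-- The action made from `σ` has two mates: `σ` itself, by `exchAt_actOfBraid`, and `bar σ`. Thus
the two conditions on `bar` and `barInv` are the invertibility statements not already contained in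
that of `σ`. -/
theorem exchInvAt_actOfBraid {X : C} (σ : X ⊗ p.P ⟶ p.P ⊗ X) (Y : C) :
    exchInvAt p.leftDual (actOfBraid (L := p.Q) p.leftDual σ) Y =
      (α_ p.Q X Y).inv ≫ p.bar σ ▷ Y ≫ (α_ X p.Q Y).hom := by
  simp only [exchInvAt, actOfBraid, bar, cupAt, actAt, evalLeft, coevL, evL]
  monoidal

theorem exchAt_actOfBraidInv {X : C} (τ : p.P ⊗ X ⟶ X ⊗ p.P) (Y : C) :
    exchAt p.rightDual (actOfBraidInv (L := p.Q) p.rightDual τ) Y =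
      (α_ X p.Q Y).inv ≫ p.barInv τ ▷ Y ≫ (α_ p.Q X Y).hom := by
  simp only [exchAt, actOfBraidInv, barInv, cupAt, actAt, evalRight, coevR, evR]
  monoidal

theorem Intertwined.compatible_plus (A : p.Intertwined) :
    Compatible (L := p.Q) (R := p.P) p.rightDual p.leftDual (actOfBraid p.leftDual A.σ.hom)
      (actOfBraidInv p.rightDual A.σ.inv) := by
  apply Compatible.of_exchAt
  · intro X
    rw [exchAt_actOfBraid, exchInvAt_actOfBraidInv]
    simp [← comp_whiskerRight_assoc]
  · intro X
    rw [exchInvAt_actOfBraid, exchAt_actOfBraidInv]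
    simp [← comp_whiskerRight_assoc, A.barInv_bar]

theorem Intertwined.compatible_minus (A : p.Intertwined) :
    Compatible (L := p.P) (R := p.Q) p.leftDual p.rightDual
      (actOfBraidInv p.rightDual A.σ.inv) (actOfBraid p.leftDual A.σ.hom) := by
  apply Compatible.of_exchAt
  · intro X
    rw [exchInvAt_actOfBraid, exchAt_actOfBraidInv]
    simp [← comp_whiskerRight_assoc, A.bar_barInv]
  · intro X
    rw [exchAt_actOfBraid, exchInvAt_actOfBraidInv]
    simp [← comp_whiskerRight_assoc]

/-- The actions of `F_±` on an intertwined object. -/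
abbrev Intertwined.toSignAction (A : p.Intertwined) : p.SignAction where
  obj := A.X
  act := p.action A
  rel := rel_of_compatible A.compatible_plus A.compatible_minus

theorem Intertwined.isHom {A B : p.Intertwined} {f : A.X ⟶ B.X}
    (h : f ▷ p.P ≫ B.σ.hom = A.σ.hom ≫ p.P ◁ f) : A.toSignAction.IsHom B.toSignAction f
  | plus => actOfBraid_naturality (d' := p.leftDual) h
  | minus => by
    refine actOfBraidInv_naturality (d := p.rightDual) ?_
    rw [Iso.comp_inv_eq, Category.assoc, h, Iso.inv_hom_id_assoc]

theorem Intertwined.comm_of_isHom {A B : p.Intertwined} {f : A.X ⟶ B.X}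
    (h : A.toSignAction.IsHom B.toSignAction f) : f ▷ p.P ≫ B.σ.hom = A.σ.hom ≫ p.P ◁ f := by
  have e := braidOfAct_naturality (d' := p.leftDual) (h plus)
  change _ ≫ braidOfAct p.leftDual (actOfBraid p.leftDual B.σ.hom) =
    braidOfAct p.leftDual (actOfBraid p.leftDual A.σ.hom) ≫ _ at e
  rwa [braidOfAct_actOfBraid, braidOfAct_actOfBraid] at e

/-- The action of `F₊` alone recovers `σ.hom` through `braidOfAct`. -/
theorem Intertwined.ext_of_action {A B : p.Intertwined} (hX : A.X = B.X)
    (h : HEq (p.action A plus) (p.action B plus)) : A = B := by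
  obtain ⟨X, σ, _, _⟩ := A
  obtain ⟨Y, τ, _, _⟩ := B
  obtain rfl : X = Y := hX
  have e := congrArg (braidOfAct p.leftDual) (eq_of_heq h)
  have e' : σ.hom = τ.hom :=
    (braidOfAct_actOfBraid (d' := p.leftDual) σ.hom).symm.trans
      (Eq.trans e (braidOfAct_actOfBraid (d' := p.leftDual) τ.hom))
  obtain rfl : σ = τ := Iso.ext e'
  rfl

theorem bar_comp_barInv {X : C} {a : p.Q ⊗ (X ⊗ p.P) ⟶ X} {b : p.P ⊗ (X ⊗ p.Q) ⟶ X}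
    (h : Compatible (L := p.P) (R := p.Q) p.leftDual p.rightDual b a) :
    p.bar (braidOfAct p.leftDual a) ≫ p.barInv (braidInvOfAct p.rightDual b) = 𝟙 _ := by
  have e := exchInvAt_exchAt h (𝟙_ C)
  rw [← actOfBraid_braidOfAct (d' := p.leftDual) a,
    ← actOfBraidInv_braidInvOfAct (d := p.rightDual) b, exchInvAt_actOfBraid,
    exchAt_actOfBraidInv] at e
  apply eq_of_whiskerRight_unit
  rw [← cancel_mono (α_ _ _ _).hom, ← cancel_epi (α_ _ _ _).inv]
  simpa using e

theorem barInv_comp_bar {X : C} {a : p.Q ⊗ (X ⊗ p.P) ⟶ X} {b : p.P ⊗ (X ⊗ p.Q) ⟶ X}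
    (h : Compatible (L := p.Q) (R := p.P) p.rightDual p.leftDual a b) :
    p.barInv (braidInvOfAct p.rightDual b) ≫ p.bar (braidOfAct p.leftDual a) = 𝟙 _ := by
  have e := exchAt_exchInvAt h (𝟙_ C)
  rw [← actOfBraid_braidOfAct (d' := p.leftDual) a,
    ← actOfBraidInv_braidInvOfAct (d := p.rightDual) b, exchInvAt_actOfBraid,
    exchAt_actOfBraidInv] at e
  apply eq_of_whiskerRight_unit
  rw [← cancel_mono (α_ _ _ _).hom, ← cancel_epi (α_ _ _ _).inv]
  simpa using e

/-- The intertwined object underlying an object with actions of `F_±`. -/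
def SignAction.toIntertwined (M : p.SignAction) : p.Intertwined where
  X := M.obj
  σ :=
    { hom := braidOfAct p.leftDual (M.act plus)
      inv := braidInvOfAct p.rightDual (M.act minus)
      hom_inv_id := braidOfAct_comp M.compatible_minus
      inv_hom_id := braidInvOfAct_comp M.compatible_plus }
  bar_barInv := bar_comp_barInv M.compatible_minus
  barInv_bar := barInv_comp_bar M.compatible_plus

theorem SignAction.action_toIntertwined (M : p.SignAction) (i : PivSign) :
    p.action M.toIntertwined i = M.act i := by
  cases i
  · exact actOfBraid_braidOfAct (d' := p.leftDual) (M.act plus)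
  · exact actOfBraidInv_braidInvOfAct (d := p.rightDual) (M.act minus)

variable [∀ X : C, HasColimit (p.index.multispan.flip.obj X)]

theorem ψ_lift_id (A : p.Intertwined) (w : List PivSign) :
    (p.ψ w).app A.X ≫ A.toSignAction.lift (𝟙 A.X) = p.iterAction A w := by
  induction w with
  | nil => exact ψNil_lift _ _
  | cons i w ih =>
    refine (ψCons_lift A.toSignAction (𝟙 A.X) i w).trans ?_
    rw [ih]
    rfl

variable (p) in
/-- The component of `ψ_±`. -/
noncomputable def ψOne (i : PivSign) (X : C) : (p.F i).obj X ⟶ p.T.obj X := (p.ψ [i]).app X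

theorem ψOne_naturality (i : PivSign) {X Y : C} (f : X ⟶ Y) :
    p.ψOne i X ≫ p.T.map f = (p.F i).map f ≫ p.ψOne i Y :=
  ((p.ψ [i]).naturality f).symm

theorem ψOne_lift (M : p.SignAction) {X : C} (f : X ⟶ M.obj) (i : PivSign) :
    p.ψOne i X ≫ M.lift f = (p.F i).map f ≫ M.act i :=
  M.ψ_lift f [i]

/-- Restriction along `ψ_±` recovers the two actions from the action of `T`. This gives fullness of
the comparison functor. -/
theorem isHom_of_lift {M N : p.SignAction} {f : M.obj ⟶ N.obj}
    (h : p.T.map f ≫ N.lift (𝟙 N.obj) = M.lift (𝟙 M.obj) ≫ f) : M.IsHom N f := fun i => by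
  have e := congrArg (p.ψOne i M.obj ≫ ·) h
  simp only [← Category.assoc] at e
  rw [ψOne_naturality, Category.assoc, ψOne_lift, ψOne_lift] at e
  simpa using e

variable [∀ X : C, PreservesColimitsOfSize.{0, 0} (tensorLeft X)]
    [∀ X : C, PreservesColimitsOfSize.{0, 0} (tensorRight X)]

theorem lift_naturality {M N : p.SignAction} {f : M.obj ⟶ N.obj} (h : M.IsHom N f) :
    p.T.map f ≫ N.lift (𝟙 N.obj) = M.lift (𝟙 M.obj) ≫ f :=
  hom_ext ((isHom_map f).comp (isHom_lift N _)) ((isHom_lift M _).comp h) (by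
    rw [reassoc_of% ψNil_naturality, ψNil_lift, reassoc_of% ψNil_lift, Category.comp_id,
      Category.id_comp])

theorem mul_lift (M : p.SignAction) :
    p.mul M.obj ≫ M.lift (𝟙 M.obj) = p.T.map (M.lift (𝟙 M.obj)) ≫ M.lift (𝟙 M.obj) :=
  hom_ext ((isHom_mul M.obj).comp (isHom_lift M _)) ((isHom_map _).comp (isHom_lift M _)) (by
    rw [reassoc_of% ψNil_naturality, ψNil_lift, reassoc_of% ψNil_mul, Category.comp_id])

theorem ψOne_mul (i : PivSign) (X : C) : p.ψOne i (p.T.obj X) ≫ p.mul X = p.freeAct i X := by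
  rw [mul, ψOne_lift, CategoryTheory.Functor.map_id, Category.id_comp]

theorem insertApp_ψOne (k : PivKind) (X : C) :
    p.insertApp k X ≫ (p.F k.sign).map (p.ψOne k.sign.neg X) ≫ p.freeAct k.sign X =
      p.evalApp k X ≫ p.ψNil X :=
  p.insertApp_ψCons k [] X

variable {X : C} {a : p.T.obj X ⟶ X}

/-- The actions of `F_±` on a `T`-module. -/
noncomputable abbrev moduleAction (hu : p.ψNil X ≫ a = 𝟙 X) (hm : p.mul X ≫ a = p.T.map a ≫ a) :
    p.SignAction where
  obj := X
  act i := p.ψOne i X ≫ a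
  rel k := by
    -- Associativity of the module turns the two successive actions into the free action on `T(X)`
    -- followed by `a`. The relation there ends in `ψ_∅`, which the unit law removes.
    have h := p.insertApp_ψOne k X
    rw [Functor.map_comp, Category.assoc, ← reassoc_of% ψOne_naturality, ← hm,
      reassoc_of% ψOne_mul, reassoc_of% h, hu, Category.comp_id]

theorem isHom_moduleAction (hu : p.ψNil X ≫ a = 𝟙 X) (hm : p.mul X ≫ a = p.T.map a ≫ a) :
    (p.free X).IsHom (moduleAction hu hm) a := fun i => by
  rw [← reassoc_of% ψOne_naturality, ← hm, reassoc_of% ψOne_mul]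

/-- Both sides are action morphisms out of the free action on `X` that restrict to the identity
along `ψ_∅`. -/
theorem lift_toIntertwined_moduleAction (hu : p.ψNil X ≫ a = 𝟙 X)
    (hm : p.mul X ≫ a = p.T.map a ≫ a) :
    (moduleAction hu hm).toIntertwined.toSignAction.lift (𝟙 X) = a := by
  refine hom_ext (isHom_lift _ _) (fun i => ?_) ((ψNil_lift _ _).trans hu.symm)
  exact (congrArg (_ ≫ ·) (action_toIntertwined (moduleAction hu hm) i)).trans
    (isHom_moduleAction hu hm i)

variable (p) in
/-- The action of `T` on intertwined objects. -/
noncomputable def modAction : p.forget ⋙ p.T ⟶ p.forget where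
  app A := A.toSignAction.lift (𝟙 A.X)
  naturality _ _ f := lift_naturality (Intertwined.isHom (Intertwined.Hom.comm f))

theorem modAction_unit (A : p.Intertwined) :
    p.bimonad.unit.app (p.forget.obj A) ≫ p.modAction.app A = 𝟙 (p.forget.obj A) :=
  ψNil_lift _ _

theorem modAction_mul (A : p.Intertwined) :
    p.bimonad.mul.app (p.forget.obj A) ≫ p.modAction.app A =
      p.T.map (p.modAction.app A) ≫ p.modAction.app A :=
  mul_lift A.toSignAction

variable (p) in
/-- The comparison functor from intertwined objects to `T`-modules. -/
noncomputable abbrev comparison : p.Intertwined ⥤ p.bimonad.toMonad.Algebra :=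
  p.bimonad.toModules p.forget p.modAction modAction_unit modAction_mul

theorem full_comparison : p.comparison.Full where
  map_surjective g :=
    ⟨⟨g.f, Intertwined.comm_of_isHom (isHom_of_lift g.h)⟩, Monad.Algebra.Hom.ext rfl⟩

theorem faithful_comparison : p.comparison.Faithful where
  map_injective h := Intertwined.Hom.ext (congrArg Monad.Algebra.Hom.f h)

theorem injective_comparison_obj : Function.Injective p.comparison.obj := by
  intro A B h
  have hX : A.X = B.X := congrArg Monad.Algebra.A h
  refine Intertwined.ext_of_action hX ?_
  -- Generalizing the module lets the equality be substituted, so the `F₊`-actions are compared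
  -- although their carriers are only propositionally equal.
  have key : ∀ M : p.bimonad.toMonad.Algebra, M = p.comparison.obj B →
      HEq (p.ψOne plus M.A ≫ M.a) (p.ψOne plus B.X ≫ B.toSignAction.lift (𝟙 B.X)) := by
    rintro _ rfl
    rfl
  have e := key _ h
  change HEq (p.ψOne plus A.X ≫ A.toSignAction.lift (𝟙 A.X)) _ at e
  rw [ψOne_lift, ψOne_lift, CategoryTheory.Functor.map_id, CategoryTheory.Functor.map_id,
    Category.id_comp, Category.id_comp] at e
  exact e

theorem surjective_comparison_obj : Function.Surjective p.comparison.obj := by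
  rintro ⟨X, a, hu, hm⟩
  refine ⟨(moduleAction (a := a) hu hm).toIntertwined, ?_⟩
  have h := lift_toIntertwined_moduleAction (a := a) hu hm
  have key : ∀ (b : p.T.obj X ⟶ X) (hu' : p.bimonad.toMonad.η.app X ≫ b = 𝟙 X)
      (hm' : p.bimonad.toMonad.μ.app X ≫ b = p.bimonad.toMonad.map b ≫ b), b = a →
      (⟨X, b, hu', hm'⟩ : p.bimonad.toMonad.Algebra) = ⟨X, a, hu, hm⟩ := by
    rintro _ _ _ rfl
    rfl
  exact key _ _ _ h

end PivotalPair

/-! ### The main theorem -/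

theorem mainTheorem7 {C : Type u} [Category.{v} C] [MonoidalCategory C]
    [∀ X : C, PreservesColimitsOfSize.{0, 0} (tensorLeft X)]
    [∀ X : C, PreservesColimitsOfSize.{0, 0} (tensorRight X)]
    (p : PivotalPair C) [∀ X : C, HasColimit (p.index.multispan.flip.obj X)] :
    -- the formulas define a unique bimonad structure on `T`
    (∃! B : BimonadOn p.T, p.IsStandard B) ∧
    ∀ B : BimonadOn p.T, p.IsStandard B →
      -- `T`-modules are the same as `P`-`Q` intertwined objects
      (∃ θ : p.forget ⋙ p.T ⟶ p.forget,
        (∀ (A : p.Intertwined) (w : List PivSign),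
          (p.ψ w).app A.X ≫ θ.app A = p.iterAction A w) ∧
        ∃ (hunit : ∀ A : p.Intertwined,
              B.unit.app (p.forget.obj A) ≫ θ.app A = 𝟙 (p.forget.obj A))
          (hmul : ∀ A : p.Intertwined,
              B.mul.app (p.forget.obj A) ≫ θ.app A = p.T.map (θ.app A) ≫ θ.app A),
          (B.toModules p.forget θ hunit hmul).Full ∧
          (B.toModules p.forget θ hunit hmul).Faithful ∧
          Function.Bijective (B.toModules p.forget θ hunit hmul).obj) ∧
      -- `T` is a Hopf monad
      B.IsHopf ∧
      -- the inverses of the fusion operators are given by explicit formulas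
      (∀ X Y : C, ∃ G : p.T.obj X ⊗ p.T.obj Y ⟶ p.T.obj (X ⊗ p.T.obj Y),
        p.IsLeftInverseFormula X Y G ∧ (∀ G', p.IsLeftInverseFormula X Y G' → G' = G) ∧
        B.leftFusion X Y ≫ G = 𝟙 (p.T.obj (X ⊗ p.T.obj Y)) ∧
        G ≫ B.leftFusion X Y = 𝟙 (p.T.obj X ⊗ p.T.obj Y)) ∧
      (∀ X Y : C, ∃ G : p.T.obj X ⊗ p.T.obj Y ⟶ p.T.obj (p.T.obj X ⊗ Y),
        p.IsRightInverseFormula X Y G ∧ (∀ G', p.IsRightInverseFormula X Y G' → G' = G) ∧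
        B.rightFusion X Y ≫ G = 𝟙 (p.T.obj (p.T.obj X ⊗ Y)) ∧
        G ≫ B.rightFusion X Y = 𝟙 (p.T.obj X ⊗ p.T.obj Y)) := by
  refine ⟨⟨p.bimonad, p.isStandard_bimonad, fun B hB => hB.eq p.isStandard_bimonad⟩,
    fun B hB => ?_⟩
  -- By uniqueness, everything need only be checked for the bimonad built from freeness.
  obtain rfl : B = p.bimonad := hB.eq p.isStandard_bimonad
  have hl : ∀ X Y : C, p.bimonad.leftFusion X Y ≫ PivotalPair.fusionInvRight (p.free Y) X = 𝟙 _ :=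
    fun X Y => PivotalPair.fusionRight_inv (p.free Y) (PivotalPair.isHom_leftFusion X Y)
      (PivotalPair.ψNil_leftFusion X Y)
  have hl' : ∀ X Y : C, PivotalPair.fusionInvRight (p.free Y) X ≫ p.bimonad.leftFusion X Y = 𝟙 _ :=
    fun X Y => PivotalPair.fusionInvRight_comp (p.free Y) (PivotalPair.isHom_leftFusion X Y)
      (PivotalPair.ψNil_leftFusion X Y)
  have hr : ∀ X Y : C, p.bimonad.rightFusion X Y ≫ PivotalPair.fusionInvLeft (p.free X) Y = 𝟙 _ :=
    fun X Y => PivotalPair.fusionLeft_inv (p.free X) (PivotalPair.isHom_rightFusion X Y)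
      (PivotalPair.ψNil_rightFusion X Y)
  have hr' : ∀ X Y : C, PivotalPair.fusionInvLeft (p.free X) Y ≫ p.bimonad.rightFusion X Y = 𝟙 _ :=
    fun X Y => PivotalPair.fusionInvLeft_comp (p.free X) (PivotalPair.isHom_rightFusion X Y)
      (PivotalPair.ψNil_rightFusion X Y)
  refine ⟨⟨p.modAction, PivotalPair.ψ_lift_id, PivotalPair.modAction_unit,
    PivotalPair.modAction_mul, PivotalPair.full_comparison, PivotalPair.faithful_comparison,
    PivotalPair.injective_comparison_obj, PivotalPair.surjective_comparison_obj⟩,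
    ⟨fun X Y => ⟨_, hl X Y, hl' X Y⟩, fun X Y => ⟨_, hr X Y, hr' X Y⟩⟩,
    fun X Y => ⟨_, PivotalPair.isLeftInverseFormula X Y, fun G hG => ?_, hl X Y, hl' X Y⟩,
    fun X Y => ⟨_, PivotalPair.isRightInverseFormula X Y, fun G hG => ?_, hr X Y, hr' X Y⟩⟩
  -- The `ψ_w ⊗ ψ_v` are jointly epic because `⊗` preserves colimits in each variable, so the
  -- formula determines the inverse.
  · exact PivotalPair.T_tensor_hom_ext fun w v =>
      (hG w v).trans (PivotalPair.isLeftInverseFormula X Y w v).symm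
  · exact PivotalPair.T_tensor_hom_ext fun w v =>
      (hG w v).trans (PivotalPair.isRightInverseFormula X Y w v).symm
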